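/- **Setting.** Let $P,X,Y,E$ be finite-dimensional Euclidean spaces, $Z:=P\times X$, $g\colon Z\to Y$, $C\subset Y$ closed, $\bar z=(\bar p,\bar x)\in Z$ with $g(\bar z)\in C$. Assume that $g$ is $C^2$ around $\bar z$ and that $C$ is $C^2$-reducible at $g(\bar z)$ to a closed convex cone $K\subset E$: there are an open neighborhood $V$ of $g(\bar z)$ and a $C^2$ mapping $h\colon V\to E$ with $h(g(\bar z))=0$, $\nabla h(g(\bar z))$ surjective and $C\cap V=\{y\in V\mid h(y)\in K\}$. Put $G:=h\circ g$ (defined near $\bar z$), $\Gamma(p):=\{x\in X\mid g(p,x)\in C\}$, $\mathrm{gph}\,\Gamma:=\{(p,x)\mid x\in\Gamma(p)\}$, and $\Psi(p,x):=N_{\Gamma(p)}(x)$ for $x\in\Gamma(p)$, $\Psi(p,x):=\emptyset$ otherwise. Fix $\bar x^*\in\Psi(\bar p,\bar x)$. **Notation.** For a set $\Omega$ and $\omega\in\Omega$, $T_\Omega(\omega)$ is the set of all $w$ for which there are $t_k\downarrow0$, $w_k\to w$ with $\omega+t_kw_k\in\Omega$; $N_\Omega(\omega)$ is the limiting normal cone,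 i.e. the set of limits of $\omega_k^*$ with $\omega_k\in\Omega$, $\omega_k\to\omega$, $\limsup_{y\to\omega_k,\,y\in\Omega}\langle\omega_k^*,y-\omega_k\rangle/\|y-\omega_k\|\le0$; $N_\Omega(\omega):=\emptyset$ for $\omega\notin\Omega$; and $\mathcal K_\Omega(\omega,\omega^*):=T_\Omega(\omega)\cap\{w\mid\langle\omega^*,w\rangle=0\}$. The graphical derivative is $D\Psi(\bar p,\bar x,\bar x^*)(v):=\{u^*\in X^*\mid(v,u^*)\in T_{\mathrm{gph}\,\Psi}(\bar p,\bar x,\bar x^*)\}$. Further, $K^*:=\{\mu\in E^*\mid\langle\mu,y\rangle\le0\ \forall y\in K\}$, $\mathrm{lin}\,K:=K\cap(-K)$, $\pi_{X^*}\colon P^*\times X^*\to X^*$ is the projection, $\mathcal M(\bar z,z^*):=\{\mu\in K^*\mid\nabla G(\bar z)^*\mu=z^*\}$, and $$\mathcal P:=\{q\in P\mid\nabla_pG(\bar z)q\in\mathrm{rge}\,\nabla_xG(\bar z)+\mathrm{lin}\,K\}.$$ **Theorem.** Suppose that - the reduced system $G(p,x)\in K$ has the Robinson stability property at $(\bar p,\bar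 x)$: there are $\kappa\ge0$ and neighborhoods $W$ of $\bar p$ and $U$ of $\bar x$ such that $\mathrm{dist}\big(x;\{x'\mid G(p,x')\in K\}\big)\le\kappa\,\mathrm{dist}\big(G(p,x);K\big)$ for all $(p,x)\in W\times U$ (where $\mathrm{dist}(x;\emptyset)=\infty$); - strict complementarity holds for $G(\bar p,x)\in K$ at $(\bar x,\bar x^*)$: there is $\mu$ in the relative interior of $N_K(G(\bar z))$ with $\bar x^*=\nabla_xG(\bar z)^*\mu$. Then for every $v=(q,u)\in\mathcal P\times X$ we have $$D\Psi(\bar p,\bar x,\bar x^*)(v)\subset\Big\{\nabla\big(\nabla_xG(\cdot)^*\hat\mu\big)(\bar z)v+\pi_{X^*}(w^*)\ \Big|\ z^*\in N_{T_{\mathrm{gph}\,\Gamma}(\bar z)}(v),\ \pi_{X^*}(z^*)=\bar x^*,\ \hat\mu\in\mathcal M(\bar z,z^*),\ w^*\in N_{\mathcal K_{\mathrm{gph}\,\Gamma}(\bar z,z^*)}(v)\Big\}.$$ If in addition $\nabla^2G(\bar z)(v,v)\in\mathrm{rge}\,\nabla G(\bar z)+\mathrm{lin}\,K$, then this inclusion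 holds as an equality. -/

import Mathlib

open Set Filter Topology

noncomputable section

namespace PCS

section Variational

variable {Z U : Type*} [NormedAddCommGroup Z] [NormedSpace ℝ Z]
  [NormedAddCommGroup U] [NormedSpace ℝ U]

/-- Bouligand–Severi tangent (contingent) cone: `w` with `z + t_k w_k ∈ Ω` for some
`t_k ↓ 0`, `w_k → w`. -/
def tangentCone (Ω : Set Z) (z : Z) : Set Z :=
  {w | ∃ (t : ℕ → ℝ) (y : ℕ → Z), (∀ k, 0 < t k) ∧ Tendsto t atTop (𝓝 0) ∧
    Tendsto y atTop (𝓝 w) ∧ ∀ k, z + t k • y k ∈ Ω}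

/-- Fréchet (regular) normal cone: `limsup ⟨zs, y - z⟩ / ‖y - z‖ ≤ 0` as `y → z` in `Ω`,
written without division. It is empty when `z ∉ Ω`. -/
def regularNormalCone (Ω : Set Z) (z : Z) : Set (StrongDual ℝ Z) :=
  {zs | z ∈ Ω ∧ ∀ ε > 0, ∀ᶠ y in 𝓝[Ω] z, zs (y - z) ≤ ε * ‖y - z‖}

/-- Limiting (Mordukhovich) normal cone. It is empty when `z ∉ Ω`. -/
def normalCone (Ω : Set Z) (z : Z) : Set (StrongDual ℝ Z) :=
  {zs | z ∈ Ω ∧ ∃ (y : ℕ → Z) (ys : ℕ → StrongDual ℝ Z),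
    (∀ k, ys k ∈ regularNormalCone Ω (y k)) ∧
    Tendsto y atTop (𝓝 z) ∧ Tendsto ys atTop (𝓝 zs)}

/-- Critical cone `T_Ω(z) ∩ {zs}^⊥`. -/
def criticalCone (Ω : Set Z) (z : Z) (zs : StrongDual ℝ Z) : Set Z :=
  tangentCone Ω z ∩ {w | zs w = 0}

/-- The dual cone `K^* = {μ | ⟨μ, y⟩ ≤ 0 for all y ∈ K}`. -/
def dualCone (K : Set Z) : Set (StrongDual ℝ Z) :=
  {μ | ∀ y ∈ K, μ y ≤ 0}

/-- Graph of a set-valued mapping. -/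
def graph (Ψ : Z → Set U) : Set (Z × U) :=
  {a | a.2 ∈ Ψ a.1}

/-- Graphical derivative: `(w, v)` is tangent to the graph of `Ψ` at `(z, u)`. -/
def graphicalDerivative (Ψ : Z → Set U) (z : Z) (u : U) (w : Z) : Set U :=
  {v | (w, v) ∈ tangentCone (graph Ψ) (z, u)}

/-- Strict complementarity for the system `f(z) ∈ Ω` at `(z, zs)`: `zs = ∇f(z)^* μ` for some `μ` in
the relative interior of the normal cone to `Ω` at `f(z)`. -/
def StrictComplementarity (f : Z → U) (Ω : Set U) (z : Z) (zs : StrongDual ℝ Z) : Prop :=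
  ∃ μ ∈ intrinsicInterior ℝ (normalCone Ω (f z)), zs = μ.comp (fderiv ℝ f z)

end Variational

section Systems

variable {P X Y E : Type*}
  [NormedAddCommGroup P] [NormedSpace ℝ P] [NormedAddCommGroup X] [NormedSpace ℝ X]
  [NormedAddCommGroup Y] [NormedSpace ℝ Y] [NormedAddCommGroup E] [NormedSpace ℝ E]

/-- The solution map `Γ(p) = {x | g(p, x) ∈ C}`. -/
def solutionMap (g : P × X → Y) (C : Set Y) (p : P) : Set X :=
  {x | g (p, x) ∈ C}

/-- The normal cone mapping `Ψ(p, x) = N_{Γ(p)}(x)`. -/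
def normalConeMap (g : P × X → Y) (C : Set Y) (z : P × X) : Set (StrongDual ℝ X) :=
  normalCone (solutionMap g C z.1) z.2

/-- Robinson stability of the system `g(p, x) ∈ C` at `z = (p, x)`; distances are extended, so the
distance to the empty set is `∞`. -/
def RobinsonStability (g : P × X → Y) (C : Set Y) (z : P × X) : Prop :=
  ∃ κ : NNReal, ∃ W ∈ 𝓝 z.1, ∃ N ∈ 𝓝 z.2, ∀ p ∈ W, ∀ x ∈ N,
    Metric.infEDist x (solutionMap g C p) ≤ κ * Metric.infEDist (g (p, x)) C

/-- `h`, restricted to the open neighbourhood `V` of `y`, is a `C²` reduction of `C` at `y` to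
the closed convex cone `K`. -/
structure IsC2Reduction (C : Set Y) (y : Y) (V : Set Y) (h : Y → E) (K : ProperCone ℝ E) :
    Prop where
  isOpen : IsOpen V
  mem : y ∈ V
  contDiffOn : ContDiffOn ℝ 2 h V
  map_eq_zero : h y = 0
  surjective : Function.Surjective (fderiv ℝ h y)
  inter_eq : C ∩ V = {w ∈ V | h w ∈ K}

/-- Partial derivative `∇_p G(z)`. -/
def partialP (G : P × X → E) (z : P × X) : P →L[ℝ] E :=
  fderiv ℝ (fun p => G (p, z.2)) z.1

/-- Partial derivative `∇_x G(z)`. -/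
def partialX (G : P × X → E) (z : P × X) : X →L[ℝ] E :=
  fderiv ℝ (fun x => G (z.1, x)) z.2

/-- The projection `π_{X^*} : P^* × X^* → X^*`, where `P^* × X^*` is the dual of `P × X`:
restriction of a functional to `{0} × X`. -/
def projDual (zs : StrongDual ℝ (P × X)) : StrongDual ℝ X :=
  zs.comp (ContinuousLinearMap.inr ℝ P X)

/-- The lineality space `lin K = K ∩ (-K)`. -/
def lin (K : ProperCone ℝ E) : Submodule ℝ E :=
  (K : PointedCone ℝ E).lineal

/-- The characteristic subspace of `P`: all `q` with `∇_p G(z) q ∈ rge ∇_x G(z) + lin K`. -/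
def characteristicSubspace (G : P × X → E) (K : ProperCone ℝ E) (z : P × X) : Set P :=
  {q | partialP G z q ∈ LinearMap.range (partialX G z).toLinearMap ⊔ lin K}

/-- The multiplier set `M(z, zs) = {μ ∈ K^* | ∇G(z)^* μ = zs}`. -/
def multipliers (G : P × X → E) (K : ProperCone ℝ E) (z : P × X)
    (zs : StrongDual ℝ (P × X)) : Set (StrongDual ℝ E) :=
  {μ | μ ∈ dualCone (K : Set E) ∧ μ.comp (fderiv ℝ G z) = zs}

/-- The set of all `∇(∇_x G(·)^* μ)(z) v + π_{X^*}(ws)` with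
`zs ∈ N_{T_{gph Γ}(z)}(v)`, `π_{X^*}(zs) = xs`, `μ ∈ M(z, zs)` and
`ws ∈ N_{K_{gph Γ}(z, zs)}(v)`; here `S` stands for `gph Γ`. -/
def derivativeEstimate (S : Set (P × X)) (G : P × X → E) (K : ProperCone ℝ E) (z : P × X)
    (xs : StrongDual ℝ X) (v : P × X) : Set (StrongDual ℝ X) :=
  {us | ∃ zs ∈ normalCone (tangentCone S z) v, projDual zs = xs ∧
    ∃ μ ∈ multipliers G K z zs, ∃ ws ∈ normalCone (criticalCone S z zs) v,
      us = fderiv ℝ (fun y => μ.comp (partialX G y)) z v + projDual ws}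

end Systems

end PCS

end

/-! Write F for ∇G and D for the second derivative of G, both at the base point z, and v = (q, u).
Both sides of the claim reduce to one condition on a multiplier μ ∈ K* of x*: F v ∈ K, μ(F v) = 0,
and u* agrees with μ ∘ D v at every y with F(0, y) ∈ lin K (`IsDerivativeMultiplier`).

For the estimate this is `mem_derivativeEstimate_iff`. Any w* in it vanishes on the preimage of lin
K under F. Conversely, a functional on X that vanishes where F(0, y) ∈ lin K extends to a normal w*
on P × X. The extension is Hahn–Banach (`exists_multiplier_of_le_norm_sub`), whose distance bound
comes from linearized stability and strict complementarity.

For the graphical derivative, stability bounds the multipliers of nearby normals. Cluster points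
exist, and difference quotients give the condition (`exists_derivativeMultiplier`). This proves the
inclusion.

For equality, strict complementarity over the characteristic subspace forces F v ∈ lin K. The
second-order hypothesis gives w with F w + D(v, v)/2 ∈ lin K, so along z + t v + t² w the map G
misses lin K by only o(t²). Stability corrects the arc to a feasible one. A quadratic penalty then
produces genuine regular normals near μ + t l, whose quotients tend to u*
(`mem_graphicalDerivative_of_strict`). This needs a strict μ; other multipliers follow by perturbing
towards the strict one and using closedness of the tangent cone. -/

namespace PCS

/-! ### Hahn–Banach multipliers, polar cones and lineality spaces -/

section Cones

variable {V E : Type*} [NormedAddCommGroup V] [NormedSpace ℝ V]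
  [NormedAddCommGroup E] [NormedSpace ℝ E]

/-- Hahn–Banach in multiplier form: a functional dominated by the distance to a convex cone along a
linear map factors through that map by a functional polar to the cone. -/
theorem exists_multiplier_of_le_norm_sub (A : V →L[ℝ] E) (xs : StrongDual ℝ V) (T : Set E)
    (h0 : (0 : E) ∈ T) (hadd : ∀ a ∈ T, ∀ b ∈ T, a + b ∈ T)
    (hsmul : ∀ c : ℝ, 0 < c → ∀ a ∈ T, c • a ∈ T) (R : ℝ)
    (hle : ∀ w, ∀ k ∈ T, xs w ≤ R * ‖A w - k‖) (hR : 0 ≤ R) :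
    ∃ μ : StrongDual ℝ E, μ.comp A = xs ∧ (∀ k ∈ T, μ k ≤ 0) ∧ ‖μ‖ ≤ R := by
  have hne : T.Nonempty := ⟨0, h0⟩
  have hd : ∀ y, ∀ k ∈ T, Metric.infDist y T ≤ ‖y - k‖ := fun y k hk => by
    rw [← dist_eq_norm]; exact Metric.infDist_le_dist_of_mem hk
  have hex : ∀ y, ∀ ε > 0, ∃ k ∈ T, ‖y - k‖ < Metric.infDist y T + ε := fun y ε hε => by
    obtain ⟨k, hk, h⟩ := (Metric.infDist_lt_iff hne).1 (lt_add_of_pos_right (Metric.infDist y T) hε)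
    exact ⟨k, hk, by rwa [← dist_eq_norm]⟩
  have hA : ∀ w, xs w ≤ R * Metric.infDist (A w) T := fun w => by
    refine le_of_forall_pos_le_add fun ε hε => ?_
    obtain ⟨k, hk, h⟩ := hex (A w) (ε / (R + 1)) (by positivity)
    have h2 : R * (ε / (R + 1)) ≤ ε := by
      rw [mul_div_assoc', div_le_iff₀ (by positivity)]; nlinarith
    nlinarith [hle w k hk, mul_le_mul_of_nonneg_left h.le hR]
  have hsm1 : ∀ c : ℝ, 0 < c → ∀ y, Metric.infDist (c • y) T ≤ c * Metric.infDist y T := by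
    intro c hc y
    refine le_of_forall_pos_le_add fun ε hε => ?_
    obtain ⟨k, hk, h⟩ := hex y (ε / c) (by positivity)
    have h1 := hd (c • y) (c • k) (hsmul c hc k hk)
    rw [← smul_sub, norm_smul, Real.norm_of_nonneg hc.le] at h1
    have h2 : c * ‖y - k‖ ≤ c * (Metric.infDist y T + ε / c) :=
      mul_le_mul_of_nonneg_left h.le hc.le
    rw [mul_add, mul_div_cancel₀ _ hc.ne'] at h2
    linarith
  have hsm : ∀ c : ℝ, 0 < c → ∀ y, R * Metric.infDist (c • y) T = c * (R * Metric.infDist y T) := by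
    intro c hc y
    have h1 := hsm1 c hc y
    have h2 := hsm1 c⁻¹ (inv_pos.2 hc) (c • y)
    rw [inv_smul_smul₀ hc.ne', inv_mul_eq_div, le_div_iff₀ hc] at h2
    have : Metric.infDist (c • y) T = c * Metric.infDist y T := by linarith
    rw [this]; ring
  have had : ∀ y z, R * Metric.infDist (y + z) T ≤
      R * Metric.infDist y T + R * Metric.infDist z T := by
    intro y z
    rw [← mul_add]
    refine mul_le_mul_of_nonneg_left ?_ hR
    refine le_of_forall_pos_le_add fun ε hε => ?_
    obtain ⟨k, hk, h⟩ := hex y (ε / 2) (by positivity)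
    obtain ⟨l, hl, h'⟩ := hex z (ε / 2) (by positivity)
    have h1 := hd (y + z) (k + l) (hadd k hk l hl)
    have h2 : ‖y + z - (k + l)‖ ≤ ‖y - k‖ + ‖z - l‖ := by
      rw [add_sub_add_comm]; exact norm_add_le _ _
    linarith
  have hker : LinearMap.ker A.toLinearMap ≤ LinearMap.ker xs.toLinearMap := by
    intro w hw
    have hw' : A w = 0 := hw
    have h1 := hle w 0 h0
    have h2 := hle (-w) 0 h0
    simp only [map_neg, hw', neg_zero, sub_zero, norm_zero, mul_zero] at h1 h2
    have h3 : xs w = 0 := le_antisymm h1 (neg_nonpos.1 h2)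
    exact h3
  obtain ⟨f, hf⟩ : ∃ f : LinearMap.range A.toLinearMap →ₗ[ℝ] ℝ,
      ∀ w, f ⟨A w, LinearMap.mem_range_self A.toLinearMap w⟩ = xs w := by
    refine ⟨(Submodule.liftQ _ xs.toLinearMap hker) ∘ₗ
      A.toLinearMap.quotKerEquivRange.symm.toLinearMap, fun w => ?_⟩
    have : A.toLinearMap.quotKerEquivRange.symm ⟨A w, LinearMap.mem_range_self A.toLinearMap w⟩ =
        Submodule.Quotient.mk w := by
      rw [LinearEquiv.symm_apply_eq]; rfl
    simp only [LinearMap.comp_apply, LinearEquiv.coe_coe, this]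
    rfl
  -- R times the distance to the convex cone T is sublinear. An extension below it is nonpositive on
  -- T, where the distance is 0, and has norm at most R, since 0 ∈ T.
  obtain ⟨g, hg, hgN⟩ := exists_extension_of_le_sublinear
    ⟨LinearMap.range A.toLinearMap, f⟩ (fun y => R * Metric.infDist y T) hsm had (by
      rintro ⟨_, w, rfl⟩
      exact (hf w).trans_le (hA w))
  have hgn : ∀ y, g y ≤ R * ‖y‖ := fun y => (hgN y).trans
    (mul_le_mul_of_nonneg_left (by simpa using hd y 0 h0) hR)
  refine ⟨g.mkContinuous R fun y => ?_, ?_, fun k hk => ?_, g.mkContinuous_norm_le hR _⟩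
  · rw [Real.norm_eq_abs, abs_le]
    refine ⟨?_, hgn y⟩
    have := hgn (-y)
    rw [map_neg, norm_neg] at this
    linarith
  · ext w
    exact (hg ⟨A w, LinearMap.mem_range_self A.toLinearMap w⟩).trans (hf w)
  · have := hgN k
    simpa [Metric.infDist_zero_of_mem hk] using this

theorem properCone_smul_mem (K : ProperCone ℝ E) {c : ℝ} (hc : 0 ≤ c) {y : E} (hy : y ∈ K) :
    c • y ∈ K := PointedCone.smul_mem (K : PointedCone ℝ E) hc hy

theorem dualCone_eq_zero_of_mem_lin {K : ProperCone ℝ E} {μ : StrongDual ℝ E}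
    (hμ : μ ∈ dualCone (K : Set E)) {y : E} (hy : y ∈ lin K) : μ y = 0 := by
  have h1 := hμ y hy.1
  have h2 := hμ (-y) hy.2
  rw [map_neg] at h2
  linarith

theorem mem_of_forall_dualCone_le {K : ProperCone ℝ E} {y : E}
    (h : ∀ μ ∈ dualCone (K : Set E), μ y ≤ 0) : y ∈ K := by
  by_contra hy
  obtain ⟨f, hf, hfy⟩ := K.hyperplane_separation_point hy
  have := h (-f) fun k hk => by
    have := hf k hk
    simpa using this
  simp only [neg_apply] at this
  linarith

theorem convex_dualCone (K : Set E) : Convex ℝ (dualCone K) := by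
  intro μ hμ ν hν a b ha hb _ y hy
  have h1 := mul_nonpos_of_nonneg_of_nonpos ha (hμ y hy)
  have h2 := mul_nonpos_of_nonneg_of_nonpos hb (hν y hy)
  simpa using add_nonpos h1 h2

theorem isClosed_dualCone (K : Set E) : IsClosed (dualCone K) := by
  have : dualCone K = ⋂ y ∈ K, {μ : StrongDual ℝ E | μ y ≤ 0} := by
    ext; simp [dualCone]
  rw [this]
  exact isClosed_biInter fun y _ => isClosed_le (by fun_prop) continuous_const

/-- A regular normal to a set closed under adding multiples of `w` is nonpositive at `w`. -/
theorem regularNormalCone_apply_nonpos {Ω : Set E} {z w : E} {zs : StrongDual ℝ E}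
    (hzs : zs ∈ regularNormalCone Ω z) (hw : ∀ s : ℝ, 0 < s → z + s • w ∈ Ω) : zs w ≤ 0 := by
  refine le_of_forall_pos_le_add fun ε hε => ?_
  have hδ : 0 < ε / (‖w‖ + 1) := by positivity
  have ht : Tendsto (fun s : ℝ => z + s • w) (𝓝[>] 0) (𝓝[Ω] z) := by
    refine tendsto_nhdsWithin_iff.2 ⟨?_, ?_⟩
    · have : Continuous fun s : ℝ => z + s • w := by fun_prop
      exact tendsto_nhdsWithin_of_tendsto_nhds (by simpa using this.tendsto 0)
    · filter_upwards [self_mem_nhdsWithin] with s hs using hw s hs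
  obtain ⟨s, hs, hs0⟩ := ((ht.eventually (hzs.2 _ hδ)).and self_mem_nhdsWithin).exists
  have hs0 : 0 < s := hs0
  simp only [add_sub_cancel_left, map_smul, smul_eq_mul, norm_smul, Real.norm_of_nonneg hs0.le]
    at hs
  have h1 : zs w ≤ ε / (‖w‖ + 1) * ‖w‖ := by
    refine le_of_mul_le_mul_left ?_ hs0
    linarith
  have h2 : ε / (‖w‖ + 1) * ‖w‖ ≤ ε := by
    rw [div_mul_eq_mul_div, div_le_iff₀ (by positivity)]; nlinarith [norm_nonneg w]
  linarith

theorem normalCone_apply_nonpos {Ω : Set E} {z w : E} {zs : StrongDual ℝ E}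
    (hzs : zs ∈ normalCone Ω z) (hw : ∀ y ∈ Ω, ∀ s : ℝ, 0 < s → y + s • w ∈ Ω) : zs w ≤ 0 := by
  obtain ⟨-, y, ys, hys, -, hlim⟩ := hzs
  have hc : Continuous fun l : StrongDual ℝ E => l w := by fun_prop
  exact le_of_tendsto ((hc.tendsto zs).comp hlim)
    (Eventually.of_forall fun k =>
      regularNormalCone_apply_nonpos (hys k) fun s hs => hw _ (hys k).1 s hs)

theorem regularNormalCone_subset_normalCone (Ω : Set E) (z : E) :
    regularNormalCone Ω z ⊆ normalCone Ω z := fun zs hzs =>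
  ⟨hzs.1, fun _ => z, fun _ => zs, fun _ => hzs, tendsto_const_nhds, tendsto_const_nhds⟩

theorem mem_normalCone_of_forall_le {Ω : Set E} {z : E} {zs : StrongDual ℝ E} (hz : z ∈ Ω)
    (h : ∀ y ∈ Ω, zs y ≤ zs z) : zs ∈ normalCone Ω z := by
  refine regularNormalCone_subset_normalCone _ _ ⟨hz, fun ε hε => ?_⟩
  filter_upwards [self_mem_nhdsWithin] with y hy
  have := h y hy
  have : 0 ≤ ε * ‖y - z‖ := by positivity
  rw [map_sub]; linarith

theorem normalCone_zero_eq_dualCone (K : ProperCone ℝ E) :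
    normalCone (K : Set E) 0 = dualCone (K : Set E) := by
  ext μ
  constructor
  · exact fun hμ w hw => normalCone_apply_nonpos hμ fun y hy s hs =>
      K.add_mem hy (properCone_smul_mem K hs.le hw)
  · exact fun hμ => mem_normalCone_of_forall_le K.zero_mem fun y hy => by simpa using hμ y hy

/-- By the bipolar theorem the common kernel of K* is lin K. In finite dimensions the functionals
vanishing on that kernel form the span of K*. -/
theorem mem_span_dualCone [FiniteDimensional ℝ E] {K : ProperCone ℝ E} {l : StrongDual ℝ E}
    (hl : ∀ y ∈ lin K, l y = 0) : l ∈ Submodule.span ℝ (dualCone (K : Set E)) := by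
  let W := (Submodule.span ℝ (dualCone (K : Set E))).map
    (ContinuousLinearMap.coeLM ℝ : StrongDual ℝ E →ₗ[ℝ] E →ₗ[ℝ] ℝ)
  have hW : (l : E →ₗ[ℝ] ℝ) ∈ W := by
    rw [← Subspace.dualCoannihilator_dualAnnihilator_eq (W := W), Submodule.mem_dualAnnihilator]
    intro y hy
    rw [Submodule.mem_dualCoannihilator] at hy
    have hy' : ∀ μ ∈ dualCone (K : Set E), μ y = 0 := fun μ hμ =>
      hy _ (Submodule.mem_map_of_mem (Submodule.subset_span hμ))
    exact hl y ⟨mem_of_forall_dualCone_le fun μ hμ => (hy' μ hμ).le,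
      mem_of_forall_dualCone_le fun μ hμ => by rw [map_neg, hy' μ hμ, neg_zero]⟩
  obtain ⟨l', hl', h⟩ := hW
  rwa [← ContinuousLinearMap.coe_injective h]

/-- Since 0 ∈ K*, the affine span of K* has as direction the span of K*, which contains `l`. A small
move along `l` therefore stays in K*. -/
theorem exists_add_smul_mem_dualCone [FiniteDimensional ℝ E] {K : ProperCone ℝ E}
    {μ l : StrongDual ℝ E} (hμ : μ ∈ intrinsicInterior ℝ (dualCone (K : Set E)))
    (hl : ∀ y ∈ lin K, l y = 0) : ∃ ε : ℝ, 0 < ε ∧ μ + ε • l ∈ dualCone (K : Set E) := by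
  obtain ⟨μ', hμ', rfl⟩ := mem_intrinsicInterior.1 hμ
  have hdir : l ∈ (affineSpan ℝ (dualCone (K : Set E))).direction := by
    rw [direction_affineSpan]
    refine Submodule.span_le.2 (fun ν hν => ?_) (mem_span_dualCone hl)
    have h0 : (0 : StrongDual ℝ E) ∈ dualCone (K : Set E) := fun y _ => le_rfl
    simpa using vsub_mem_vectorSpan ℝ hν h0
  have hmem : ∀ ε : ℝ, (μ' : StrongDual ℝ E) + ε • l ∈ affineSpan ℝ (dualCone (K : Set E)) := by
    intro ε
    rw [add_comm]
    exact AffineSubspace.vadd_mem_of_mem_direction (Submodule.smul_mem _ ε hdir) μ'.2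
  have hc : Continuous fun ε : ℝ =>
      (⟨(μ' : StrongDual ℝ E) + ε • l, hmem ε⟩ : affineSpan ℝ (dualCone (K : Set E))) := by
    fun_prop
  have h0 : Tendsto (fun ε : ℝ =>
      (⟨(μ' : StrongDual ℝ E) + ε • l, hmem ε⟩ : affineSpan ℝ (dualCone (K : Set E))))
      (𝓝[>] 0) (𝓝 μ') := by
    refine tendsto_nhdsWithin_of_tendsto_nhds ?_
    convert hc.tendsto 0
    simp
  obtain ⟨ε, hε, hε0⟩ := ((h0.eventually (mem_interior_iff_mem_nhds.1 hμ')).and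
    self_mem_nhdsWithin).exists
  exact ⟨ε, hε0, hε⟩

/-- Testing μ - ε ν ∈ K* at y, where μ vanishes, gives ν y ≥ 0 for each ν ∈ K*; hence -y ∈ K by the
bipolar theorem. -/
theorem mem_lin_of_strict [FiniteDimensional ℝ E] {K : ProperCone ℝ E} {μ : StrongDual ℝ E}
    (hμ : ∀ l : StrongDual ℝ E, (∀ y ∈ lin K, l y = 0) →
      ∃ ε : ℝ, 0 < ε ∧ μ + ε • l ∈ dualCone (K : Set E))
    {y : E} (hy : y ∈ K) (h0 : μ y = 0) : y ∈ lin K := by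
  refine ⟨hy, mem_of_forall_dualCone_le fun ν hν => ?_⟩
  obtain ⟨ε, hε, h⟩ := hμ (-ν) fun y hy => by
    simp [dualCone_eq_zero_of_mem_lin hν hy]
  have := h y hy
  simp only [add_apply, smul_apply,
    neg_apply, h0, smul_eq_mul, zero_add] at this
  rw [map_neg]
  by_contra hlt
  push Not at hlt
  nlinarith

/-- A functional vanishing on `A ⁻¹ L` factors through `A` by a functional vanishing on `L`. -/
theorem exists_comp_eq_of_vanish [FiniteDimensional ℝ E] (A : V →L[ℝ] E) (W : Submodule ℝ E)
    (a : StrongDual ℝ V) (ha : ∀ y, A y ∈ W → a y = 0) :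
    ∃ l : StrongDual ℝ E, l.comp A = a ∧ ∀ y ∈ W, l y = 0 := by
  let f : V →ₗ[ℝ] E ⧸ W := W.mkQ ∘ₗ A.toLinearMap
  have hmem : (a : V →ₗ[ℝ] ℝ) ∈ LinearMap.range f.dualMap := by
    rw [LinearMap.range_dualMap_eq_dualAnnihilator_ker, Submodule.mem_dualAnnihilator]
    intro y hy
    refine ha y ?_
    simpa [f] using hy
  obtain ⟨ρ, hρ⟩ := hmem
  refine ⟨LinearMap.toContinuousLinearMap (ρ ∘ₗ W.mkQ), ?_, fun y hy => ?_⟩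
  · ext y
    exact LinearMap.congr_fun hρ y
  · have : W.mkQ y = 0 := by simpa using hy
    simp [this]

end Cones

end PCS

namespace PCS

/-! ### Tangent cones and second-order expansions -/

section Calculus

variable {Z E : Type*} [NormedAddCommGroup Z] [NormedSpace ℝ Z]
  [NormedAddCommGroup E] [NormedSpace ℝ E]

theorem mem_tangentCone_iff {Ω : Set Z} {z w : Z} : w ∈ tangentCone Ω z ↔
    ∀ ε > 0, ∃ t : ℝ, 0 < t ∧ t < ε ∧ ∃ y, ‖y - w‖ < ε ∧ z + t • y ∈ Ω := by
  constructor
  · rintro ⟨t, y, ht, ht0, hy, hmem⟩ ε hε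
    obtain ⟨k, hk1, hk2⟩ := ((ht0.eventually (gt_mem_nhds hε)).and
      (hy.eventually (Metric.ball_mem_nhds w hε))).exists
    exact ⟨t k, ht k, hk1, y k, by rwa [← dist_eq_norm], hmem k⟩
  · intro h
    choose t ht htε y hy hmem using fun k : ℕ => h (1 / (k + 1 : ℝ)) (by positivity)
    refine ⟨t, y, ht, ?_, ?_, hmem⟩
    · exact squeeze_zero (fun k => (ht k).le) (fun k => (htε k).le)
        tendsto_one_div_add_atTop_nhds_zero_nat
    · rw [tendsto_iff_norm_sub_tendsto_zero]
      exact squeeze_zero (fun k => norm_nonneg _) (fun k => (hy k).le)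
        tendsto_one_div_add_atTop_nhds_zero_nat

theorem isClosed_tangentCone (Ω : Set Z) (z : Z) : IsClosed (tangentCone Ω z) := by
  refine isClosed_of_closure_subset fun w hw => mem_tangentCone_iff.2 fun ε hε => ?_
  obtain ⟨w', hw', hd⟩ := Metric.mem_closure_iff.1 hw (ε / 2) (by positivity)
  obtain ⟨t, ht, htε, y, hy, hmem⟩ := mem_tangentCone_iff.1 hw' (ε / 2) (by positivity)
  refine ⟨t, ht, by linarith, y, ?_, hmem⟩
  rw [dist_comm, dist_eq_norm] at hd
  calc ‖y - w‖ = ‖(y - w') + (w' - w)‖ := by congr 1; abel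
    _ ≤ _ := norm_add_le _ _
    _ < ε := by linarith

theorem mem_tangentCone_of_eventually {Ω : Set Z} {z w : Z} {t : ℕ → ℝ} {y : ℕ → Z}
    (ht : ∀ k, 0 < t k) (ht0 : Tendsto t atTop (𝓝 0)) (hy : Tendsto y atTop (𝓝 w))
    (hmem : ∀ᶠ k in atTop, z + t k • y k ∈ Ω) : w ∈ tangentCone Ω z := by
  obtain ⟨N, hN⟩ := eventually_atTop.1 hmem
  exact ⟨fun k => t (k + N), fun k => y (k + N), fun k => ht _,
    ht0.comp (tendsto_add_atTop_nat N), hy.comp (tendsto_add_atTop_nat N),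
    fun k => hN _ (Nat.le_add_left _ _)⟩

theorem tendsto_add_smul {z w : Z} {t : ℕ → ℝ} {y : ℕ → Z}
    (ht0 : Tendsto t atTop (𝓝 0)) (hy : Tendsto y atTop (𝓝 w)) :
    Tendsto (fun k => z + t k • y k) atTop (𝓝 z) := by
  simpa using (ht0.smul hy).const_add z

theorem HasFDerivAt.tendsto_inv_smul_sub {f : Z → E} {f' : Z →L[ℝ] E} {z w : Z}
    (hf : HasFDerivAt f f' z) {t : ℕ → ℝ} {y : ℕ → Z} (ht : ∀ k, 0 < t k)
    (ht0 : Tendsto t atTop (𝓝 0)) (hy : Tendsto y atTop (𝓝 w)) :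
    Tendsto (fun k => (t k)⁻¹ • (f (z + t k • y k) - f z)) atTop (𝓝 (f' w)) := by
  refine (hasFDerivWithinAt_univ.2 hf).lim (c := fun k => (t k)⁻¹) (d := fun k => t k • y k)
    (l := atTop) ?_ (by simp) ?_
  · simpa using ht0.smul hy
  · refine hy.congr fun k => ?_
    rw [inv_smul_smul₀ (ht k).ne']

/-- Second-order Taylor expansion. -/
theorem taylor_two_isLittleO {f : Z → E} {z : Z} (hf : ContDiffAt ℝ 2 f z) :
    (fun w => f (z + w) - f z - fderiv ℝ f z w - (1 / 2 : ℝ) • fderiv ℝ (fderiv ℝ f) z w w)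
      =o[𝓝 0] fun w => ‖w‖ ^ 2 := by
  set D := fderiv ℝ (fderiv ℝ f) z with hD
  have hsymm : ∀ a b, D a b = D b a := hf.isSymmSndFDerivAt (by simp)
  have hdf : ∀ᶠ y in 𝓝 z, DifferentiableAt ℝ f y :=
    (hf.eventually (by simp)).mono fun y hy => hy.differentiableAt (by simp)
  have hD1 : HasFDerivAt (fderiv ℝ f) D z :=
    ((hf.fderiv_right (m := 1) (by norm_num)).differentiableAt (by simp)).hasFDerivAt
  rw [Asymptotics.isLittleO_iff]
  intro ε hε
  have h1 : ∀ᶠ w in 𝓝 (0 : Z), DifferentiableAt ℝ f (z + w) ∧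
      ‖fderiv ℝ f (z + w) - fderiv ℝ f z - D w‖ ≤ ε * ‖w‖ := by
    have ht : Tendsto (fun w : Z => z + w) (𝓝 0) (𝓝 z) := by
      simpa using (continuous_const_add z).tendsto (0 : Z)
    exact (ht.eventually hdf).and
      ((hasFDerivAt_iff_isLittleO_nhds_zero.1 hD1).def hε)
  obtain ⟨r, hr, hball⟩ := Metric.eventually_nhds_iff_ball.1 h1
  filter_upwards [Metric.ball_mem_nhds (0 : Z) hr] with w hw
  have hwr : ‖w‖ < r := by simpa using hw
  have hsub : ∀ y ∈ Metric.closedBall (0 : Z) ‖w‖, y ∈ Metric.ball (0 : Z) r := fun y hy => by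
    simp only [Metric.mem_closedBall, dist_zero_right, Metric.mem_ball] at hy ⊢
    linarith
  -- By symmetry of D the remainder has derivative `fderiv ℝ f (z + y) - fderiv ℝ f z - D y`, which
  -- is at most ε‖w‖ on the ball of radius ‖w‖. The mean value inequality then gives ε‖w‖².
  have hder : ∀ y ∈ Metric.closedBall (0 : Z) ‖w‖, HasFDerivWithinAt
      (fun w => f (z + w) - f z - fderiv ℝ f z w - (1 / 2 : ℝ) • D w w)
      (fderiv ℝ f (z + y) - fderiv ℝ f z - D y) (Metric.closedBall (0 : Z) ‖w‖) y := by
    intro y hy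
    have hd1 : HasFDerivAt (fun w => f (z + w)) (fderiv ℝ f (z + y)) y :=
      (hball y (hsub y hy)).1.hasFDerivAt.comp y ((hasFDerivAt_id y).const_add z)
    have hd2 : HasFDerivAt (fun w => D w w) (D y + D.flip y) y := by
      have := D.hasFDerivAt (x := y) |>.clm_apply (hasFDerivAt_id y)
      exact this
    have hd3 := ((hd1.sub_const (f z)).sub (fderiv ℝ f z).hasFDerivAt).sub
      (hd2.const_smul (1 / 2 : ℝ))
    refine (hd3.congr_fderiv ?_).hasFDerivWithinAt
    have : D.flip y = D y := by ext b; exact hsymm b y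
    rw [this, ← two_smul ℝ (D y), smul_smul]
    norm_num
  have := (convex_closedBall (0 : Z) ‖w‖).norm_image_sub_le_of_norm_hasFDerivWithin_le
    (C := ε * ‖w‖) hder (fun y hy => ((hball y (hsub y hy)).2).trans (by
      have : ‖y‖ ≤ ‖w‖ := by simpa using hy
      gcongr)) (x := 0) (y := w) (by simp) (by simp)
  simp only [add_zero, sub_self, map_zero, sub_zero, smul_zero] at this
  rw [Real.norm_of_nonneg (by positivity : 0 ≤ ‖w‖ ^ 2)]
  convert this using 1
  ring

/-- Expansion along the arcs z + t v + t² y. It measures at order t² how far such an arc is from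
feasibility. -/
theorem ContDiffAt.tendsto_inv_sq_smul_sub {f : Z → E} {z v w : Z} (hf : ContDiffAt ℝ 2 f z)
    {t : ℕ → ℝ} {y : ℕ → Z} (ht : ∀ k, 0 < t k)
    (ht0 : Tendsto t atTop (𝓝 0)) (hy : Tendsto y atTop (𝓝 w)) :
    Tendsto (fun k => (t k ^ 2)⁻¹ • (f (z + t k • (v + t k • y k)) - f z - t k • fderiv ℝ f z v))
      atTop (𝓝 (fderiv ℝ f z w + (1 / 2 : ℝ) • fderiv ℝ (fderiv ℝ f) z v v)) := by
  set D := fderiv ℝ (fderiv ℝ f) z with hD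
  have hv : Tendsto (fun k => v + t k • y k) atTop (𝓝 v) := tendsto_add_smul ht0 hy
  have hw0 : Tendsto (fun k => t k • (v + t k • y k)) atTop (𝓝 0) := by simpa using ht0.smul hv
  have ho := (taylor_two_isLittleO hf).comp_tendsto hw0
  have hO : ((fun w : Z => ‖w‖ ^ 2) ∘ fun k => t k • (v + t k • y k)) =O[atTop]
      fun k => t k ^ 2 := by
    have h1 : (fun k => ‖v + t k • y k‖) =O[atTop] fun _ => (1 : ℝ) :=
      hv.norm.isBigO_one ℝ
    have h2 := ((Asymptotics.isBigO_refl t atTop).mul h1).pow 2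
    refine (Asymptotics.isBigO_congr (Eventually.of_forall fun k => ?_)
      (Eventually.of_forall fun k => ?_)).1 h2
    · simp only [Function.comp_apply, norm_smul, Real.norm_of_nonneg (ht k).le]
    · simp
  have hlim := (Asymptotics.isLittleO_iff_tendsto' (𝕜 := ℝ) (f := fun k =>
    ‖f (z + t k • (v + t k • y k)) - f z - fderiv ℝ f z (t k • (v + t k • y k)) -
      (1 / 2 : ℝ) • D (t k • (v + t k • y k)) (t k • (v + t k • y k))‖) (g := fun k => t k ^ 2)
      (l := atTop) (Eventually.of_forall fun k h => absurd h (by have := ht k; positivity))).1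
      ((ho.trans_isBigO hO).norm_left)
  have hlim' : Tendsto (fun k => (t k ^ 2)⁻¹ • (f (z + t k • (v + t k • y k)) - f z -
      fderiv ℝ f z (t k • (v + t k • y k)) -
      (1 / 2 : ℝ) • D (t k • (v + t k • y k)) (t k • (v + t k • y k)))) atTop (𝓝 0) := by
    rw [tendsto_zero_iff_norm_tendsto_zero]
    refine hlim.congr fun k => ?_
    rw [norm_smul, norm_inv, Real.norm_of_nonneg (by positivity : 0 ≤ t k ^ 2)]
    rw [div_eq_inv_mul]
  have h2 : Tendsto (fun k => fderiv ℝ f z (y k) +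
      (1 / 2 : ℝ) • D (v + t k • y k) (v + t k • y k)) atTop
      (𝓝 (fderiv ℝ f z w + (1 / 2 : ℝ) • D v v)) := by
    have hc : Continuous fun p : Z × Z => fderiv ℝ f z p.1 + (1 / 2 : ℝ) • D p.2 p.2 := by
      fun_prop
    exact (hc.tendsto (w, v)).comp (hy.prodMk_nhds hv)
  have h3 := hlim'.add h2
  rw [zero_add] at h3
  refine h3.congr fun k => ?_
  have hk := (ht k).ne'
  have hk2 : t k ^ 2 ≠ 0 := pow_ne_zero 2 hk
  have e1 : f (z + t k • (v + t k • y k)) - f z - fderiv ℝ f z (t k • (v + t k • y k)) -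
      (1 / 2 : ℝ) • D (t k • (v + t k • y k)) (t k • (v + t k • y k)) =
      (f (z + t k • (v + t k • y k)) - f z - t k • fderiv ℝ f z v) -
        t k ^ 2 • (fderiv ℝ f z (y k) + (1 / 2 : ℝ) • D (v + t k • y k) (v + t k • y k)) := by
    generalize f (z + t k • (v + t k • y k)) - f z = X
    rw [map_smul (fderiv ℝ f z), map_add (fderiv ℝ f z), map_smul (fderiv ℝ f z), map_smul D,
      smul_apply, map_smul (D (v + t k • y k))]
    generalize D (v + t k • y k) (v + t k • y k) = Q
    module
  rw [e1, smul_sub, inv_smul_smul₀ hk2, sub_add_cancel]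

end Calculus

end PCS

namespace PCS

/-! ### Consequences of Robinson stability: tangents, linearization, bounded multipliers -/

section LocalSystem

variable {P X E : Type*}
  [NormedAddCommGroup P] [NormedSpace ℝ P] [NormedAddCommGroup X] [NormedSpace ℝ X]
  [NormedAddCommGroup E] [NormedSpace ℝ E]

/-- The estimate of Robinson stability at a single point `z`, with an attained bound. -/
def StableAt (G : P × X → E) (S : Set (P × X)) (K : ProperCone ℝ E) (c : ℝ) (z : P × X) : Prop :=
  ∀ k ∈ K, ∃ x', (z.1, x') ∈ S ∧ G (z.1, x') ∈ K ∧ ‖x' - z.2‖ ≤ c * ‖G z - k‖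

/-- Near `z`, the set `S` is given by the smooth Robinson-stable conic system `G ∈ K`, where
`G z = 0`. -/
structure LocalSystem (G : P × X → E) (S : Set (P × X)) (K : ProperCone ℝ E) (c : ℝ)
    (z : P × X) : Prop where
  contDiffAt : ContDiffAt ℝ 2 G z
  map_eq_zero : G z = 0
  nonneg : 0 ≤ c
  mem_iff : ∀ᶠ y in 𝓝 z, (y ∈ S ↔ G y ∈ K)
  stable : ∀ᶠ y in 𝓝 z, StableAt G S K c y

theorem RobinsonStability.exists_localSystem {G : P × X → E} {S : Set (P × X)}
    {K : ProperCone ℝ E} {z : P × X} (hR : RobinsonStability G (K : Set E) z)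
    (hG : ContDiffAt ℝ 2 G z) (h0 : G z = 0) (hS : ∀ᶠ y in 𝓝 z, (y ∈ S ↔ G y ∈ K)) :
    ∃ c, LocalSystem G S K c z := by
  obtain ⟨κ, W, hW, N, hN, hκ⟩ := hR
  -- Raising the modulus by 1 makes the distance bound strict when the residual is positive, so a
  -- point attaining it exists; for zero residual the point itself serves.
  refine ⟨κ + 1, hG, h0, by positivity, hS, ?_⟩
  obtain ⟨r, hr, hball⟩ := Metric.eventually_nhds_iff_ball.1 hS
  have hGs : ∀ᶠ y in 𝓝 z, ‖G y‖ < r / 2 / (κ + 1) := by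
    have : Tendsto (fun y => ‖G y‖) (𝓝 z) (𝓝 0) := by
      simpa [h0] using hG.continuousAt.norm.tendsto
    exact this.eventually (gt_mem_nhds (by positivity))
  filter_upwards [hGs, Metric.ball_mem_nhds z (half_pos hr), prod_mem_nhds hW hN]
    with y hy hyr hyWN
  have hyr' : dist y.1 z.1 < r / 2 ∧ dist y.2 z.2 < r / 2 := by
    simpa [Prod.dist_eq] using hyr
  have key : ∀ k ∈ K, ‖G y - k‖ ≤ ‖G y‖ → ∃ x', (y.1, x') ∈ S ∧ G (y.1, x') ∈ K ∧
      ‖x' - y.2‖ ≤ (κ + 1) * ‖G y - k‖ := by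
    intro k hk hle
    rcases (norm_nonneg (G y - k)).eq_or_lt with h | h
    · have hk' : G y = k := sub_eq_zero.1 (norm_eq_zero.1 h.symm)
      have hyK : G y ∈ K := hk' ▸ hk
      have hyb : y ∈ Metric.ball z r := Metric.ball_subset_ball (by linarith) hyr
      exact ⟨y.2, (hball y hyb).2 hyK, hyK, by simpa using by positivity⟩
    · have h1 := hκ y.1 hyWN.1 y.2 hyWN.2
      have h2 : Metric.infEDist (G (y.1, y.2)) (K : Set E) ≤ ENNReal.ofReal ‖G y - k‖ := by
        refine (Metric.infEDist_le_edist_of_mem hk).trans ?_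
        rw [edist_dist, dist_eq_norm]
      have h3 : Metric.infEDist y.2 (solutionMap G (K : Set E) y.1) <
          ENNReal.ofReal ((κ + 1) * ‖G y - k‖) := by
        refine (h1.trans (mul_le_mul_right h2 _)).trans_lt ?_
        rw [← ENNReal.ofReal_coe_nnreal, ← ENNReal.ofReal_mul κ.coe_nonneg,
          ENNReal.ofReal_lt_ofReal_iff (by positivity)]
        linarith
      obtain ⟨x', hx', hd⟩ := Metric.infEDist_lt_iff.1 h3
      rw [edist_dist, ENNReal.ofReal_lt_ofReal_iff (by positivity), dist_comm, dist_eq_norm] at hd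
      have hx'r : ‖x' - y.2‖ < r / 2 := by
        refine hd.trans ?_
        have : (κ + 1 : ℝ) * ‖G y‖ < r / 2 := by
          rwa [lt_div_iff₀ (by positivity), mul_comm] at hy
        exact (mul_le_mul_of_nonneg_left hle (by positivity)).trans_lt this
      have hxb : (y.1, x') ∈ Metric.ball z r := by
        rw [Metric.mem_ball, Prod.dist_eq, max_lt_iff]
        refine ⟨by have := hyr'.1; simp only; linarith, ?_⟩
        have := dist_triangle x' y.2 z.2
        rw [dist_eq_norm x' y.2] at this
        have h5 := hyr'.2
        simp only
        linarith
      exact ⟨x', (hball _ hxb).2 hx', hx', hd.le⟩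
  intro k hk
  rcases le_or_gt ‖G y - k‖ ‖G y‖ with h | h
  · exact key k hk h
  -- A cone point farther from `G y` than the origin is replaced by 0; this keeps x' in the ball
  -- where S is described by G.
  · obtain ⟨x', h1, h2, h3⟩ := key 0 K.zero_mem (by simp)
    refine ⟨x', h1, h2, h3.trans ?_⟩
    rw [sub_zero]
    gcongr

namespace LocalSystem

variable {G : P × X → E} {S : Set (P × X)} {K : ProperCone ℝ E} {c : ℝ} {z : P × X}

theorem eventually_differentiableAt (h : LocalSystem G S K c z) :
    ∀ᶠ y in 𝓝 z, DifferentiableAt ℝ G y :=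
  (h.contDiffAt.eventually (by simp)).mono fun y hy => hy.differentiableAt (by simp)

theorem hasFDerivAt (h : LocalSystem G S K c z) : HasFDerivAt G (fderiv ℝ G z) z :=
  h.eventually_differentiableAt.self_of_nhds.hasFDerivAt

theorem hasFDerivAt_fderiv (h : LocalSystem G S K c z) :
    HasFDerivAt (fderiv ℝ G) (fderiv ℝ (fderiv ℝ G) z) z :=
  ((h.contDiffAt.fderiv_right (m := 1) (by norm_num)).differentiableAt (by simp)).hasFDerivAt

theorem eventually_continuousAt_fderiv (h : LocalSystem G S K c z) :
    ∀ᶠ y in 𝓝 z, ContinuousAt (fderiv ℝ G) y :=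
  (h.contDiffAt.eventually (by simp)).mono fun y hy =>
    (hy.fderiv_right (m := 1) (by norm_num)).continuousAt

/-- The scaled values of `G` along a sequence tangent to `w` tend to `∇G(z) w`. -/
theorem tendsto_inv_smul (h : LocalSystem G S K c z) {t : ℕ → ℝ} {y : ℕ → P × X} {w : P × X}
    (ht : ∀ k, 0 < t k) (ht0 : Tendsto t atTop (𝓝 0)) (hy : Tendsto y atTop (𝓝 w)) :
    Tendsto (fun k => (t k)⁻¹ • G (z + t k • y k)) atTop (𝓝 (fderiv ℝ G z w)) := by
  simpa [h.map_eq_zero] using HasFDerivAt.tendsto_inv_smul_sub h.hasFDerivAt ht ht0 hy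

theorem fderiv_mem_of_eventually (h : LocalSystem G S K c z) {t : ℕ → ℝ} {y : ℕ → P × X}
    {w : P × X} (ht : ∀ k, 0 < t k) (ht0 : Tendsto t atTop (𝓝 0)) (hy : Tendsto y atTop (𝓝 w))
    (hmem : ∀ᶠ k in atTop, G (z + t k • y k) ∈ K) : fderiv ℝ G z w ∈ K :=
  K.isClosed.mem_of_tendsto (h.tendsto_inv_smul ht ht0 hy)
    (hmem.mono fun k hk => properCone_smul_mem K (inv_nonneg.2 (ht k).le) hk)

/-- Stability at z + t w against the cone point t k, divided by t. Only the X-component is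
corrected, since stability keeps the parameter fixed. -/
theorem exists_stable_seq (h : LocalSystem G S K c z) {t : ℕ → ℝ} {w : ℕ → P × X} {w' : P × X}
    (ht : ∀ k, 0 < t k) (ht0 : Tendsto t atTop (𝓝 0)) (hw : Tendsto w atTop (𝓝 w'))
    {k : ℕ → E} (hk : ∀ n, k n ∈ K) :
    ∃ y : ℕ → X, ∀ᶠ n in atTop, z + t n • ((w n).1, y n) ∈ S ∧ G (z + t n • ((w n).1, y n)) ∈ K ∧
      ‖y n - (w n).2‖ ≤ c * ‖(t n)⁻¹ • G (z + t n • w n) - k n‖ := by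
  have h1 := (tendsto_add_smul (z := z) ht0 hw).eventually h.stable
  refine Filter.Eventually.choice (r := fun n y => z + t n • ((w n).1, y) ∈ S ∧
    G (z + t n • ((w n).1, y)) ∈ K ∧
    ‖y - (w n).2‖ ≤ c * ‖(t n)⁻¹ • G (z + t n • w n) - k n‖) (h1.mono fun n hn => ?_)
  obtain ⟨x', hS, hK, hle⟩ := hn (t n • k n) (properCone_smul_mem K (ht n).le (hk n))
  have e : z + t n • ((w n).1, (t n)⁻¹ • (x' - z.2)) = ((z + t n • w n).1, x') := by
    ext <;> simp [smul_inv_smul₀ (ht n).ne']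
  refine ⟨(t n)⁻¹ • (x' - z.2), by rwa [e], by rwa [e], ?_⟩
  have e1 : (t n)⁻¹ • (x' - z.2) - (w n).2 = (t n)⁻¹ • (x' - (z + t n • w n).2) := by
    rw [Prod.snd_add, Prod.smul_snd, ← sub_sub, smul_sub _ (x' - z.2), inv_smul_smul₀ (ht n).ne']
  have e2 : (t n)⁻¹ • G (z + t n • w n) - k n = (t n)⁻¹ • (G (z + t n • w n) - t n • k n) := by
    rw [smul_sub, inv_smul_smul₀ (ht n).ne']
  rw [e1, e2, norm_smul, norm_smul, mul_left_comm]
  exact mul_le_mul_of_nonneg_left hle (norm_nonneg _)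

theorem tendsto_one_div_pos : (∀ n : ℕ, 0 < (1 / (n + 1) : ℝ)) ∧
    Tendsto (fun n : ℕ => (1 / (n + 1) : ℝ)) atTop (𝓝 0) :=
  ⟨fun n => by positivity, tendsto_one_div_add_atTop_nhds_zero_nat⟩

/-- If ∇G(z) w ∈ K, then z + t w misses feasibility by o(t), and stability repairs this with a
correction of order o(t). -/
theorem tangentCone_eq (h : LocalSystem G S K c z) :
    tangentCone S z = {w | fderiv ℝ G z w ∈ K} := by
  ext w
  constructor
  · rintro ⟨t, y, ht, ht0, hy, hmem⟩
    refine h.fderiv_mem_of_eventually ht ht0 hy ?_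
    filter_upwards [(tendsto_add_smul ht0 hy).eventually h.mem_iff] with k hk using hk.1 (hmem k)
  · intro hw
    obtain ⟨ht, ht0⟩ := tendsto_one_div_pos
    obtain ⟨y, hy⟩ := h.exists_stable_seq ht ht0 (tendsto_const_nhds (x := w))
      (k := fun _ => fderiv ℝ G z w) (fun _ => hw)
    have hlim : Tendsto y atTop (𝓝 w.2) := by
      rw [tendsto_iff_norm_sub_tendsto_zero]
      refine squeeze_zero' (Eventually.of_forall fun n => norm_nonneg _)
        (hy.mono fun n hn => hn.2.2) ?_
      have := ((h.tendsto_inv_smul ht ht0 (tendsto_const_nhds (x := w))).sub_const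
        (fderiv ℝ G z w)).norm.const_mul c
      simpa using this
    exact mem_tangentCone_of_eventually ht ht0
      ((tendsto_const_nhds (x := w.1)).prodMk_nhds hlim) (hy.mono fun n hn => hn.1)

/-- The linearized system inherits the stability estimate. -/
theorem exists_linearized [FiniteDimensional ℝ X] (h : LocalSystem G S K c z) (w : P × X) {k : E}
    (hk : k ∈ K) : ∃ y, fderiv ℝ G z (w.1, y) ∈ K ∧ ‖y - w.2‖ ≤ c * ‖fderiv ℝ G z w - k‖ := by
  obtain ⟨ht, ht0⟩ := tendsto_one_div_pos
  obtain ⟨y, hy⟩ := h.exists_stable_seq ht ht0 (tendsto_const_nhds (x := w))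
    (k := fun _ => k) (fun _ => hk)
  have hlim := ((h.tendsto_inv_smul ht ht0 (tendsto_const_nhds (x := w))).sub_const k).norm.const_mul
    c
  have hb : ∀ᶠ n in atTop, y n ∈ Metric.closedBall w.2 (c * ‖fderiv ℝ G z w - k‖ + 1) := by
    filter_upwards [hy, hlim.eventually (gt_mem_nhds (lt_add_one _))] with n h1 h2
    rw [Metric.mem_closedBall, dist_eq_norm]
    exact h1.2.2.trans h2.le
  obtain ⟨y', -, φ, hφ, hyφ⟩ :=
    tendsto_subseq_of_frequently_bounded Metric.isBounded_closedBall hb.frequently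
  refine ⟨y', ?_, ?_⟩
  · refine h.fderiv_mem_of_eventually (t := fun n => 1 / ((φ n : ℕ) + 1 : ℝ))
      (y := fun n => (w.1, y (φ n))) (fun n => ht _) (ht0.comp hφ.tendsto_atTop)
      (tendsto_const_nhds.prodMk_nhds hyφ) ?_
    exact (hφ.tendsto_atTop.eventually hy).mono fun n hn => hn.2.1
  · exact le_of_tendsto_of_tendsto ((hyφ.sub_const w.2).norm) (hlim.comp hφ.tendsto_atTop)
      ((hφ.tendsto_atTop.eventually hy).mono fun n hn => hn.2.2)

end LocalSystem

/-- Multipliers of regular normals to the fibers, bounded by the stability modulus. -/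
theorem exists_multiplier_of_regularNormal {G : P × X → E} {S : Set (P × X)} {K : ProperCone ℝ E}
    {c : ℝ} (hc : 0 ≤ c) {p : P} {x : X} (hd : DifferentiableAt ℝ G (p, x)) (hK : G (p, x) ∈ K)
    (hst : ∀ᶠ y in 𝓝 (p, x), StableAt G S K c y) {xs : StrongDual ℝ X}
    (hxs : xs ∈ regularNormalCone {x' | (p, x') ∈ S} x) :
    ∃ μ ∈ dualCone (K : Set E), μ (G (p, x)) = 0 ∧
      μ.comp ((fderiv ℝ G (p, x)).comp (ContinuousLinearMap.inr ℝ P X)) = xs ∧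
      ‖μ‖ ≤ c * ‖xs‖ := by
  set A := (fderiv ℝ G (p, x)).comp (ContinuousLinearMap.inr ℝ P X) with hA
  set g := G (p, x) with hg
  -- The cone of feasible directions of K at `g`. A functional polar to it lies in K* and vanishes
  -- at `g`.
  let T : Set E := {k | ∃ k0 ∈ K, ∃ s : ℝ, 0 ≤ s ∧ k = k0 - s • g}
  have hle : ∀ w, ∀ k ∈ T, xs w ≤ (c * ‖xs‖) * ‖A w - k‖ := by
    rintro w _ ⟨k0, hk0, s, hs, rfl⟩
    obtain ⟨ht, ht0⟩ := LocalSystem.tendsto_one_div_pos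
    set t : ℕ → ℝ := fun n => 1 / (n + 1 : ℝ) with htdef
    have hz : Tendsto (fun n => (p, x) + t n • ((0 : P), w)) atTop (𝓝 (p, x)) :=
      tendsto_add_smul ht0 tendsto_const_nhds
    have hts : ∀ᶠ n in atTop, t n * s ≤ 1 := by
      have : Tendsto (fun n => t n * s) atTop (𝓝 0) := by simpa using ht0.mul_const s
      exact (this.eventually (gt_mem_nhds one_pos)).mono fun n hn => hn.le
    set b : ℕ → ℝ := fun n =>
      c * ‖(t n)⁻¹ • (G ((p, x) + t n • ((0 : P), w)) - g) - (k0 - s • g)‖ with hb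
    have hblim : Tendsto b atTop (𝓝 (c * ‖A w - (k0 - s • g)‖)) :=
      ((HasFDerivAt.tendsto_inv_smul_sub hd.hasFDerivAt ht ht0
        (tendsto_const_nhds (x := ((0 : P), w)))).sub_const _).norm.const_mul c
    have hex : ∀ᶠ n in atTop, ∃ x', (p, x') ∈ S ∧ ‖x' - (x + t n • w)‖ ≤ t n * b n := by
      filter_upwards [hz.eventually hst, hts] with n hn hn1
      -- The point g + t (k0 - s g) lies in K once t s ≤ 1, so stability applies with a residual of
      -- order t.
      obtain ⟨x', h1, -, h3⟩ := hn ((1 - t n * s) • g + t n • k0)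
        (K.add_mem (properCone_smul_mem K (by linarith) hK) (properCone_smul_mem K (ht n).le hk0))
      refine ⟨x', by simpa using h1, ?_⟩
      have e : G ((p, x) + t n • ((0 : P), w)) - ((1 - t n * s) • g + t n • k0) =
          t n • ((t n)⁻¹ • (G ((p, x) + t n • ((0 : P), w)) - g) - (k0 - s • g)) := by
        rw [smul_sub, smul_inv_smul₀ (ht n).ne']
        module
      rw [e, norm_smul, Real.norm_of_nonneg (ht n).le, mul_left_comm] at h3
      exact h3
    obtain ⟨x', hx'⟩ := hex.choice
    have hx'lim : Tendsto x' atTop (𝓝 x) := by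
      have h1 : Tendsto (fun n => x' n - (x + t n • w)) atTop (𝓝 0) := by
        rw [tendsto_zero_iff_norm_tendsto_zero]
        exact squeeze_zero' (Eventually.of_forall fun n => norm_nonneg _)
          (hx'.mono fun n hn => hn.2) (by simpa using ht0.mul hblim)
      have h2 : Tendsto (fun n => x + t n • w) atTop (𝓝 x) :=
        tendsto_add_smul ht0 tendsto_const_nhds
      simpa using h1.add h2
    have hx'in : Tendsto x' atTop (𝓝[{x' | (p, x') ∈ S}] x) :=
      tendsto_nhdsWithin_iff.2 ⟨hx'lim, hx'.mono fun n hn => hn.1⟩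
    have hε : ∀ ε > 0, xs w ≤ ε * (‖w‖ + c * ‖A w - (k0 - s • g)‖) +
        ‖xs‖ * (c * ‖A w - (k0 - s • g)‖) := by
      intro ε hε
      have hl : Tendsto (fun n => ε * (‖w‖ + b n) + ‖xs‖ * b n) atTop
          (𝓝 (ε * (‖w‖ + c * ‖A w - (k0 - s • g)‖) + ‖xs‖ * (c * ‖A w - (k0 - s • g)‖))) :=
        ((hblim.const_add _).const_mul _).add (hblim.const_mul _)
      refine ge_of_tendsto hl ?_
      filter_upwards [hx', hx'in.eventually (hxs.2 ε hε)] with n h1 h2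
      -- The first term is small because x' is feasible and `xs` is a regular normal; the second is
      -- bounded by the stability correction.
      have e : t n * xs w = xs (x' n - x) - xs (x' n - (x + t n • w)) := by
        rw [← map_sub, ← smul_eq_mul, ← map_smul]
        congr 1
        abel
      have h3 : -xs (x' n - (x + t n • w)) ≤ ‖xs‖ * (t n * b n) :=
        (neg_le_abs _).trans ((xs.le_opNorm _).trans
          (mul_le_mul_of_nonneg_left h1.2 (norm_nonneg _)))
      have h4 : ‖x' n - x‖ ≤ t n * (‖w‖ + b n) := by
        calc ‖x' n - x‖ = ‖(x' n - (x + t n • w)) + t n • w‖ := by congr 1; abel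
          _ ≤ ‖x' n - (x + t n • w)‖ + ‖t n • w‖ := norm_add_le _ _
          _ ≤ t n * b n + t n * ‖w‖ := by
            rw [norm_smul, Real.norm_of_nonneg (ht n).le]; gcongr; exact h1.2
          _ = _ := by ring
      have h5 := mul_le_mul_of_nonneg_left h4 hε.le
      refine le_of_mul_le_mul_left ?_ (ht n)
      linarith
    have hl : Tendsto (fun ε : ℝ => ε * (‖w‖ + c * ‖A w - (k0 - s • g)‖) +
        ‖xs‖ * (c * ‖A w - (k0 - s • g)‖)) (𝓝[>] 0)
        (𝓝 (‖xs‖ * (c * ‖A w - (k0 - s • g)‖))) := by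
      have : Continuous fun ε : ℝ => ε * (‖w‖ + c * ‖A w - (k0 - s • g)‖) +
        ‖xs‖ * (c * ‖A w - (k0 - s • g)‖) := by fun_prop
      exact tendsto_nhdsWithin_of_tendsto_nhds (by simpa using this.tendsto 0)
    have := ge_of_tendsto hl (by filter_upwards [self_mem_nhdsWithin] with ε h using hε ε h)
    linarith
  obtain ⟨μ, h1, h2, h3⟩ := exists_multiplier_of_le_norm_sub A xs T
    ⟨0, K.zero_mem, 0, le_rfl, by simp⟩
    (by
      rintro _ ⟨a, ha, s, hs, rfl⟩ _ ⟨b, hb, r, hr, rfl⟩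
      exact ⟨a + b, K.add_mem ha hb, s + r, by positivity, by module⟩)
    (by
      rintro r hr _ ⟨a, ha, s, hs, rfl⟩
      exact ⟨r • a, properCone_smul_mem K hr.le ha, r * s, by positivity, by module⟩)
    (c * ‖xs‖) hle (by positivity)
  have hμ : μ ∈ dualCone (K : Set E) := fun k hk => h2 k ⟨k, hk, 0, le_rfl, by simp⟩
  refine ⟨μ, hμ, le_antisymm (hμ g hK) ?_, h1, h3⟩
  have := h2 (-g) ⟨0, K.zero_mem, 1, zero_le_one, by simp⟩
  rw [map_neg] at this
  linarith

/-- Limiting normals inherit multipliers by compactness: the bound c‖x*‖ is uniform near z, and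
bounded sets in the dual of E are relatively compact. -/
theorem LocalSystem.eventually_exists_multiplier [FiniteDimensional ℝ E] {G : P × X → E}
    {S : Set (P × X)} {K : ProperCone ℝ E} {c : ℝ} {z : P × X} (h : LocalSystem G S K c z) :
    ∀ᶠ y in 𝓝 z, ∀ xs ∈ normalCone {x' | (y.1, x') ∈ S} y.2,
      ∃ μ ∈ dualCone (K : Set E), μ (G y) = 0 ∧
        μ.comp ((fderiv ℝ G y).comp (ContinuousLinearMap.inr ℝ P X)) = xs ∧
        ‖μ‖ ≤ c * ‖xs‖ := by
  filter_upwards [h.eventually_continuousAt_fderiv, h.eventually_differentiableAt,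
    (h.eventually_differentiableAt.and (h.mem_iff.and h.stable)).eventually_nhds]
    with y hc hd hy xs hxs
  obtain ⟨hyS, x, ys, hreg, hx, hys⟩ := hxs
  have hyx : Tendsto (fun n => (y.1, x n)) atTop (𝓝 y) :=
    (tendsto_const_nhds (x := y.1)).prodMk_nhds hx
  have hex : ∀ᶠ n in atTop, ∃ μ ∈ dualCone (K : Set E), μ (G (y.1, x n)) = 0 ∧
      μ.comp ((fderiv ℝ G (y.1, x n)).comp (ContinuousLinearMap.inr ℝ P X)) = ys n ∧
        ‖μ‖ ≤ c * ‖ys n‖ := by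
    filter_upwards [hyx.eventually hy.eventually_nhds] with n hn
    obtain ⟨h1, h2, -⟩ := hn.self_of_nhds
    exact exists_multiplier_of_regularNormal h.nonneg h1 (h2.1 (hreg n).1)
      (hn.mono fun y hy => hy.2.2) (hreg n)
  obtain ⟨μ, hμ⟩ := hex.choice
  have hb : ∀ᶠ n in atTop, μ n ∈ Metric.closedBall (0 : StrongDual ℝ E) (c * ‖xs‖ + 1) := by
    filter_upwards [hμ, (hys.norm.const_mul c).eventually (gt_mem_nhds (lt_add_one _))]
      with n h1 h2
    rw [mem_closedBall_zero_iff]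
    exact h1.2.2.2.trans h2.le
  obtain ⟨m, -, φ, hφ, hm⟩ :=
    tendsto_subseq_of_frequently_bounded Metric.isBounded_closedBall hb.frequently
  have hμφ := hφ.tendsto_atTop.eventually hμ
  have hyφ := hyx.comp hφ.tendsto_atTop
  have hap : Continuous fun q : StrongDual ℝ E × E => q.1 q.2 := by fun_prop
  have hco : Continuous fun q : StrongDual ℝ E × (P × X →L[ℝ] E) =>
      q.1.comp (q.2.comp (ContinuousLinearMap.inr ℝ P X)) := by fun_prop
  refine ⟨m, (isClosed_dualCone _).mem_of_tendsto hm (hμφ.mono fun n hn => hn.1), ?_, ?_, ?_⟩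
  · refine tendsto_nhds_unique ((hap.tendsto (m, G y)).comp
      (hm.prodMk_nhds (hd.continuousAt.tendsto.comp hyφ))) ?_
    exact tendsto_const_nhds.congr' (hμφ.mono fun n hn => hn.2.1.symm)
  · refine tendsto_nhds_unique ((hco.tendsto (m, fderiv ℝ G y)).comp
      (hm.prodMk_nhds (hc.tendsto.comp hyφ))) ?_
    exact (hys.comp hφ.tendsto_atTop).congr' (hμφ.mono fun n hn => hn.2.2.1.symm)
  · exact le_of_tendsto_of_tendsto hm.norm ((hys.norm.const_mul c).comp hφ.tendsto_atTop)
      (hμφ.mono fun n hn => hn.2.2.2)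

end LocalSystem

end PCS

namespace PCS

/-! ### Reduction of the estimate to multipliers, and the inclusion -/

section Estimate

variable {P X E : Type*}
  [NormedAddCommGroup P] [NormedSpace ℝ P] [NormedAddCommGroup X] [NormedSpace ℝ X]
  [NormedAddCommGroup E] [NormedSpace ℝ E]

theorem partialX_eq {G : P × X → E} {z : P × X} (h : DifferentiableAt ℝ G z) :
    partialX G z = (fderiv ℝ G z).comp (ContinuousLinearMap.inr ℝ P X) :=
  (HasFDerivAt.comp z.2 (g := G) (f := fun x => (z.1, x)) h.hasFDerivAt
    (hasFDerivAt_prodMk_right z.1 z.2)).fderiv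

theorem partialP_eq {G : P × X → E} {z : P × X} (h : DifferentiableAt ℝ G z) :
    partialP G z = (fderiv ℝ G z).comp (ContinuousLinearMap.inl ℝ P X) :=
  (HasFDerivAt.comp z.1 (g := G) (f := fun p => (p, z.2)) h.hasFDerivAt
    (hasFDerivAt_prodMk_left z.1 z.2)).fderiv

/-- `μ` is a multiplier for `xs` and the direction `v`, for which `us` is an element of the derivative
estimate. -/
structure IsDerivativeMultiplier (G : P × X → E) (K : ProperCone ℝ E) (z : P × X)
    (xs : StrongDual ℝ X) (v : P × X) (us : StrongDual ℝ X) (μ : StrongDual ℝ E) : Prop where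
  mem : μ ∈ dualCone (K : Set E)
  comp_eq : μ.comp ((fderiv ℝ G z).comp (ContinuousLinearMap.inr ℝ P X)) = xs
  tangent : fderiv ℝ G z v ∈ K
  compl : μ (fderiv ℝ G z v) = 0
  apply_eq : ∀ y, fderiv ℝ G z (0, y) ∈ lin K → us y = μ (fderiv ℝ (fderiv ℝ G) z v (0, y))

/-- `μ` is a strictly complementary multiplier for `xs`. -/
structure IsStrictMultiplier (G : P × X → E) (K : ProperCone ℝ E) (z : P × X)
    (xs : StrongDual ℝ X) (μ : StrongDual ℝ E) : Prop where
  mem : μ ∈ dualCone (K : Set E)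
  comp_eq : μ.comp ((fderiv ℝ G z).comp (ContinuousLinearMap.inr ℝ P X)) = xs
  strict : ∀ l : StrongDual ℝ E, (∀ y ∈ lin K, l y = 0) →
    ∃ ε : ℝ, 0 < ε ∧ μ + ε • l ∈ dualCone (K : Set E)

namespace LocalSystem

variable {G : P × X → E} {S : Set (P × X)} {K : ProperCone ℝ E} {c : ℝ} {z : P × X}

theorem fderiv_comp_partialX (h : LocalSystem G S K c z) (μ : StrongDual ℝ E) (v : P × X) :
    fderiv ℝ (fun y => μ.comp (partialX G y)) z v =
      μ.comp ((fderiv ℝ (fderiv ℝ G) z v).comp (ContinuousLinearMap.inr ℝ P X)) := by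
  have he : (fun y => μ.comp (partialX G y)) =ᶠ[𝓝 z]
      fun y => ((ContinuousLinearMap.compL ℝ X E ℝ μ).comp
        ((ContinuousLinearMap.compL ℝ X (P × X) E).flip (ContinuousLinearMap.inr ℝ P X)))
        (fderiv ℝ G y) := by
    filter_upwards [h.eventually_differentiableAt] with y hy
    rw [partialX_eq hy]
    rfl
  have hd := (ContinuousLinearMap.hasFDerivAt
    ((ContinuousLinearMap.compL ℝ X E ℝ μ).comp
      ((ContinuousLinearMap.compL ℝ X (P × X) E).flip (ContinuousLinearMap.inr ℝ P X)))).comp z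
    h.hasFDerivAt_fderiv
  rw [he.fderiv_eq]
  exact DFunLike.congr_fun hd.fderiv v

theorem exists_fderiv_mem_lin (h : LocalSystem G S K c z) {q : P}
    (hq : q ∈ characteristicSubspace G K z) : ∃ y, fderiv ℝ G z (q, y) ∈ lin K := by
  have hd := h.eventually_differentiableAt.self_of_nhds
  obtain ⟨_, ⟨y, rfl⟩, l, hl, he⟩ := Submodule.mem_sup.1 hq
  refine ⟨-y, ?_⟩
  have e : fderiv ℝ G z (q, -y) = l := by
    rw [partialP_eq hd, partialX_eq hd] at he
    have e1 : ((q, -y) : P × X) = (q, 0) - (0, y) := by simp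
    rw [e1, map_sub, sub_eq_iff_eq_add, add_comm]
    exact he.symm
  rwa [e]

/-- Under strict complementarity, critical directions over the characteristic subspace are mapped to
the lineality space. -/
theorem fderiv_mem_lin [FiniteDimensional ℝ E] (h : LocalSystem G S K c z)
    {xs : StrongDual ℝ X} {μ₀ μ : StrongDual ℝ E} (hμ₀ : IsStrictMultiplier G K z xs μ₀) {q : P}
    (hq : q ∈ characteristicSubspace G K z) {u : X} (hμ : μ ∈ dualCone (K : Set E))
    (hμc : μ.comp ((fderiv ℝ G z).comp (ContinuousLinearMap.inr ℝ P X)) = xs)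
    (ht : fderiv ℝ G z (q, u) ∈ K) (hc : μ (fderiv ℝ G z (q, u)) = 0) :
    fderiv ℝ G z (q, u) ∈ lin K := by
  refine mem_lin_of_strict hμ₀.strict ht ?_
  obtain ⟨y, hy⟩ := h.exists_fderiv_mem_lin hq
  have e : fderiv ℝ G z (q, u) = fderiv ℝ G z (q, y) + fderiv ℝ G z (0, u - y) := by
    rw [← map_add]; simp
  -- All multipliers of `xs` take the same value at ∇G(z)(q, u), because this vector differs from an
  -- element of lin K by ∇_xG(z)(u - y). Hence μ₀ vanishes there too, and strictness applies.
  have key : ∀ ν ∈ dualCone (K : Set E),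
      ν.comp ((fderiv ℝ G z).comp (ContinuousLinearMap.inr ℝ P X)) = xs →
      ν (fderiv ℝ G z (q, u)) = xs (u - y) := by
    rintro ν hν rfl
    rw [e, map_add, dualCone_eq_zero_of_mem_lin hν hy, zero_add]
    rfl
  rw [key μ₀ hμ₀.mem hμ₀.comp_eq, ← key μ hμ hμc, hc]

theorem criticalCone_eq (h : LocalSystem G S K c z) (μ : StrongDual ℝ E) :
    criticalCone S z (μ.comp (fderiv ℝ G z)) =
      {w | fderiv ℝ G z w ∈ K ∧ μ (fderiv ℝ G z w) = 0} := by
  rw [criticalCone, h.tangentCone_eq]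
  rfl

/-- Functionals annihilating the critical subspace of the fiber extend to functionals polar to the
critical cone of the graph. -/
theorem exists_extension_polar [FiniteDimensional ℝ X] [FiniteDimensional ℝ E]
    (h : LocalSystem G S K c z) {xs : StrongDual ℝ X} {μ₀ μ : StrongDual ℝ E}
    (hμ₀ : IsStrictMultiplier G K z xs μ₀)
    (hμc : μ.comp ((fderiv ℝ G z).comp (ContinuousLinearMap.inr ℝ P X)) = xs)
    {a : StrongDual ℝ X} (ha : ∀ y, fderiv ℝ G z (0, y) ∈ lin K → a y = 0) :
    ∃ ws : StrongDual ℝ (P × X), projDual ws = a ∧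
      ∀ w, fderiv ℝ G z w ∈ K → μ (fderiv ℝ G z w) = 0 → ws w ≤ 0 := by
  set F := fderiv ℝ G z with hF
  obtain ⟨l, hla, hl⟩ := exists_comp_eq_of_vanish
    (F.comp (ContinuousLinearMap.inr ℝ P X)) (lin K) a ha
  have hla' : ∀ y, a y = l (F (0, y)) := fun y => by rw [← hla]; rfl
  have hxs : ∀ y, xs y = μ (F (0, y)) := fun y => by rw [← hμc]; rfl
  have hxs₀ : ∀ y, xs y = μ₀ (F (0, y)) := fun y => by rw [← hμ₀.comp_eq]; rfl
  obtain ⟨ε, hε, hmem⟩ := hμ₀.strict l hl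
  have hc := h.nonneg
  -- The constant R in a y ≤ R ‖(0, y) - w‖, for w critical, collects three costs: replacing y by
  -- y', moving y' to the linearized feasible y'', and bounding a y''.
  obtain ⟨ws, h1, h2, -⟩ := exists_multiplier_of_le_norm_sub (ContinuousLinearMap.inr ℝ P X) a
    {w | F w ∈ K ∧ μ (F w) = 0} ⟨by simp, by simp⟩
    (fun w hw w' hw' => ⟨by rw [map_add]; exact K.add_mem hw.1 hw'.1, by simp [hw.2, hw'.2]⟩)
    (fun s hs w hw => ⟨by rw [map_smul]; exact properCone_smul_mem K hs.le hw.1, by simp [hw.2]⟩)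
    (‖a‖ + ‖a‖ * (c * ‖F‖) + (‖μ‖ * ‖F‖ + ‖xs‖ * (c * ‖F‖)) / ε) (by
      rintro y ⟨q, y'⟩ ⟨hK, h0⟩
      set N := ‖(ContinuousLinearMap.inr ℝ P X) y - (q, y')‖ with hN
      have hN' : N = max ‖q‖ ‖y - y'‖ := by simp [hN, Prod.norm_def]
      have hq : ‖q‖ ≤ N := hN' ▸ le_max_left _ _
      have hy : ‖y - y'‖ ≤ N := hN' ▸ le_max_right _ _
      have hFq : ‖F (q, 0)‖ ≤ ‖F‖ * N := by
        refine (F.le_opNorm _).trans ?_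
        gcongr
        simpa [Prod.norm_def] using hq
      have hsplit : F (q, y') = F (q, 0) + F (0, y') := by rw [← map_add]; simp
      -- Dropping q changes the image by F(q, 0) only, so linearized stability finds y'' nearby with
      -- F(0, y'') ∈ K. There μ₀ + ε l ∈ K* turns into ε a y'' ≤ -x* y''.
      obtain ⟨y'', hy''K, hy''⟩ := h.exists_linearized (0, y') hK
      have hd : ‖y'' - y'‖ ≤ c * ‖F‖ * N := by
        refine hy''.trans ?_
        rw [mul_assoc]
        gcongr
        rw [← hF, hsplit, sub_add_cancel_right, norm_neg]
        exact hFq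
      have e1 : a y = a (y - y') - a (y'' - y') + a y'' := by
        rw [← map_sub, ← map_add]; congr 1; abel
      have b1 : a (y - y') ≤ ‖a‖ * N := (le_abs_self _).trans ((a.le_opNorm _).trans (by gcongr))
      have b2 : -a (y'' - y') ≤ ‖a‖ * (c * ‖F‖ * N) :=
        (neg_le_abs _).trans ((a.le_opNorm _).trans (by gcongr))
      have b3 : -xs (y'' - y') ≤ ‖xs‖ * (c * ‖F‖ * N) :=
        (neg_le_abs _).trans ((xs.le_opNorm _).trans (by gcongr))
      have b4 : -xs y' ≤ ‖μ‖ * (‖F‖ * N) := by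
        have : -xs y' = μ (F (q, 0)) := by
          rw [hsplit, map_add, ← hxs] at h0
          linarith
        rw [this]
        exact (le_abs_self _).trans ((μ.le_opNorm _).trans (by gcongr))
      have b5 : ε * a y'' ≤ -xs y'' := by
        have := hmem _ hy''K
        simp only [add_apply, smul_apply, smul_eq_mul] at this
        rw [hla', hxs₀]
        linarith
      have b6 : a y'' ≤ (‖μ‖ * ‖F‖ + ‖xs‖ * (c * ‖F‖)) / ε * N := by
        rw [div_mul_eq_mul_div, le_div_iff₀ hε]
        have : xs (y'' - y') = xs y'' - xs y' := map_sub _ _ _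
        nlinarith
      rw [e1]
      nlinarith)
    (by positivity)
  exact ⟨ws, h1, fun w hw hw0 => h2 w ⟨hw, hw0⟩⟩

/-- The critical cone is invariant under adding vectors that ∇G(z) maps into lin K, so each of its
normals vanishes on them. Conversely, (q, u) is itself such a vector by strict complementarity, so a
functional polar to the critical cone vanishes at (q, u) and is a normal there. -/
theorem mem_derivativeEstimate_iff [FiniteDimensional ℝ X] [FiniteDimensional ℝ E]
    (h : LocalSystem G S K c z) {xs : StrongDual ℝ X} {μ₀ : StrongDual ℝ E}
    (hμ₀ : IsStrictMultiplier G K z xs μ₀) {q : P} (hq : q ∈ characteristicSubspace G K z)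
    (u : X) (us : StrongDual ℝ X) :
    us ∈ derivativeEstimate S G K z xs (q, u) ↔
      ∃ μ, IsDerivativeMultiplier G K z xs (q, u) us μ := by
  constructor
  · rintro ⟨_, -, rfl, μ, ⟨hμ, rfl⟩, ws, hws, rfl⟩
    have hv := hws.1
    rw [h.criticalCone_eq] at hws hv
    refine ⟨μ, hμ, rfl, hv.1, hv.2, fun y hy => ?_⟩
    have h0 := dualCone_eq_zero_of_mem_lin hμ hy
    have hpos : ∀ w, fderiv ℝ G z w ∈ lin K → ws w ≤ 0 := by
      intro w hw
      refine normalCone_apply_nonpos hws fun b hb s hs => ⟨?_, ?_⟩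
      · rw [map_add, map_smul]
        exact K.add_mem hb.1 (properCone_smul_mem K hs.le hw.1)
      · rw [map_add, map_smul, map_add, map_smul, hb.2, dualCone_eq_zero_of_mem_lin hμ hw]
        simp
    have h1 := hpos (0, y) hy
    have h2 := hpos (-(0, y)) (by rw [map_neg]; exact Submodule.neg_mem _ hy)
    rw [map_neg] at h2
    have h3 : ws (0, y) = 0 := by linarith
    rw [h.fderiv_comp_partialX]
    simp [projDual, h3]
  · rintro ⟨μ, hμ⟩
    have hlin := h.fderiv_mem_lin hμ₀ hq hμ.mem hμ.comp_eq hμ.tangent hμ.compl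
    obtain ⟨ws, hwsa, hws⟩ := h.exists_extension_polar hμ₀ hμ.comp_eq
      (a := us - μ.comp ((fderiv ℝ (fderiv ℝ G) z (q, u)).comp (ContinuousLinearMap.inr ℝ P X)))
      (fun y hy => by simp [hμ.apply_eq y hy])
    refine ⟨μ.comp (fderiv ℝ G z), ?_, hμ.comp_eq, μ, ⟨hμ.mem, rfl⟩, ws, ?_, ?_⟩
    · rw [h.tangentCone_eq]
      refine mem_normalCone_of_forall_le hμ.tangent fun w hw => ?_
      exact (hμ.mem _ hw).trans hμ.compl.ge
    · rw [h.criticalCone_eq]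
      refine mem_normalCone_of_forall_le ⟨hμ.tangent, hμ.compl⟩ fun w hw => ?_
      refine (hws w hw.1 hw.2).trans ?_
      have := hws (-(q, u)) (by rw [map_neg]; exact hlin.2) (by rw [map_neg, map_neg, hμ.compl, neg_zero])
      rw [map_neg] at this
      linarith
    · rw [h.fderiv_comp_partialX, hwsa]
      abel

/-- The bounded multipliers of the normals x* + t u* at z + t v have a cluster point. On y with
∇G(z)(0, y) ∈ lin K every element of K* vanishes, so the uncontrolled change of the multiplier drops
out and only the change of ∇G contributes to u* y. -/
theorem exists_derivativeMultiplier [FiniteDimensional ℝ E] (h : LocalSystem G S K c z)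
    {xs us : StrongDual ℝ X} {v : P × X}
    (hus : us ∈ graphicalDerivative (fun y => normalCone {x | (y.1, x) ∈ S} y.2) z xs v) :
    ∃ μ, IsDerivativeMultiplier G K z xs v us μ := by
  obtain ⟨t, y, ht, ht0, hy, hmem⟩ := hus
  have hw : Tendsto (fun n => (y n).1) atTop (𝓝 v) := (continuous_fst.tendsto (v, us)).comp hy
  have hs : Tendsto (fun n => (y n).2) atTop (𝓝 us) := (continuous_snd.tendsto (v, us)).comp hy
  have hz := tendsto_add_smul (z := z) ht0 hw
  have hxs := tendsto_add_smul (z := xs) ht0 hs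
  have hmem' : ∀ n, xs + t n • (y n).2 ∈ normalCone {x | ((z + t n • (y n).1).1, x) ∈ S}
    (z + t n • (y n).1).2 := hmem
  have hzS : ∀ n, z + t n • (y n).1 ∈ S := fun n => (hmem' n).1
  obtain ⟨μ, hμ⟩ := ((hz.eventually h.eventually_exists_multiplier).mono
    fun n hn => hn _ (hmem' n)).choice
  have hb : ∀ᶠ n in atTop, μ n ∈ Metric.closedBall (0 : StrongDual ℝ E) (c * ‖xs‖ + 1) := by
    filter_upwards [hμ, (hxs.norm.const_mul c).eventually (gt_mem_nhds (lt_add_one _))]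
      with n h1 h2
    rw [mem_closedBall_zero_iff]
    exact h1.2.2.2.trans h2.le
  obtain ⟨m, -, φ, hφ, hm⟩ :=
    tendsto_subseq_of_frequently_bounded Metric.isBounded_closedBall hb.frequently
  have hφt := hφ.tendsto_atTop
  have hμφ := hφt.eventually hμ
  have hap : Continuous fun q : StrongDual ℝ E × E => q.1 q.2 := by fun_prop
  have hco : Continuous fun q : StrongDual ℝ E × (P × X →L[ℝ] E) =>
      q.1.comp (q.2.comp (ContinuousLinearMap.inr ℝ P X)) := by fun_prop
  have hmK : m ∈ dualCone (K : Set E) :=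
    (isClosed_dualCone _).mem_of_tendsto hm (hμφ.mono fun n hn => hn.1)
  have hmc : m.comp ((fderiv ℝ G z).comp (ContinuousLinearMap.inr ℝ P X)) = xs := by
    refine tendsto_nhds_unique ((hco.tendsto (m, fderiv ℝ G z)).comp
      (hm.prodMk_nhds (h.hasFDerivAt_fderiv.continuousAt.tendsto.comp (hz.comp hφt)))) ?_
    exact (hxs.comp hφt).congr' (hμφ.mono fun n hn => hn.2.2.1.symm)
  refine ⟨m, hmK, hmc, ?_, ?_, fun b hb => ?_⟩
  · refine h.fderiv_mem_of_eventually ht ht0 hw ?_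
    filter_upwards [hz.eventually h.mem_iff] with n hn using hn.1 (hzS n)
  · refine tendsto_nhds_unique ((hap.tendsto (m, fderiv ℝ G z v)).comp
      (hm.prodMk_nhds ((h.tendsto_inv_smul ht ht0 hw).comp hφt))) ?_
    refine tendsto_const_nhds.congr' (hμφ.mono fun n hn => ?_)
    have := hn.2.1
    simp only [Function.comp_apply, map_smul, this, smul_zero]
  · have hev : Tendsto (fun n => (y n).2 b) atTop (𝓝 (us b)) := by
      have hc : Continuous fun l : StrongDual ℝ X => l b := by fun_prop
      exact (hc.tendsto us).comp hs
    have hD := HasFDerivAt.tendsto_inv_smul_sub h.hasFDerivAt_fderiv ht ht0 hw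
    have hDb : Tendsto (fun n => ((t n)⁻¹ • (fderiv ℝ G (z + t n • (y n).1) - fderiv ℝ G z))
        (0, b)) atTop (𝓝 (fderiv ℝ (fderiv ℝ G) z v (0, b))) := by
      have hc : Continuous fun l : P × X →L[ℝ] E => l (0, b) := by fun_prop
      exact (hc.tendsto _).comp hD
    refine tendsto_nhds_unique (hev.comp hφt) ?_
    refine ((hap.tendsto (m, _)).comp (hm.prodMk_nhds (hDb.comp hφt))).congr' ?_
    refine hμφ.mono fun n hn => ?_
    have e1 := DFunLike.congr_fun hn.2.2.1 b
    have e2 := DFunLike.congr_fun hmc b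
    have e3 : μ (φ n) (fderiv ℝ G z (0, b)) = 0 := dualCone_eq_zero_of_mem_lin hn.1 hb
    have e4 : m (fderiv ℝ G z (0, b)) = 0 := dualCone_eq_zero_of_mem_lin hmK hb
    have e2' : xs b = 0 := e2.symm.trans e4
    have e1' : μ (φ n) (fderiv ℝ G (z + t (φ n) • (y (φ n)).1) (0, b)) =
        t (φ n) * (y (φ n)).2 b := by
      refine e1.trans ?_
      simp [e2']
    simp only [Function.comp_apply, smul_apply, sub_apply, map_smul, map_sub, e1', e3, sub_zero,
      smul_eq_mul]
    rw [inv_mul_cancel_left₀ (ht _).ne']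

end LocalSystem

end Estimate

end PCS

namespace PCS

/-! ### The reverse inclusion: constructing normals along corrected arcs -/

section Realization

variable {P X E : Type*}
  [NormedAddCommGroup P] [NormedSpace ℝ P] [NormedAddCommGroup X] [InnerProductSpace ℝ X]
  [NormedAddCommGroup E] [NormedSpace ℝ E]

/-- The negative gradient at a local minimizer is a regular normal. -/
theorem neg_mem_regularNormalCone_of_isLocalMinOn {f : X → ℝ} {f' : StrongDual ℝ X} {Ω : Set X}
    {x : X} (hx : x ∈ Ω) (hf : HasFDerivAt f f' x) (hmin : ∀ᶠ y in 𝓝[Ω] x, f x ≤ f y) :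
    -f' ∈ regularNormalCone Ω x := by
  refine ⟨hx, fun ε hε => ?_⟩
  have h1 := (hasFDerivAt_iff_isLittleO.1 hf).def hε
  filter_upwards [hmin, nhdsWithin_le_nhds h1] with y hy1 hy2
  have h2 := (le_abs_self _).trans hy2
  rw [neg_apply]
  linarith

/-- A nearly optimal point for a multiplier is close to a point with a nearby regular normal: minimize
with a quadratic penalty. -/
theorem exists_regularNormal_of_penalty [FiniteDimensional ℝ X] {G : P × X → E} {S : Set (P × X)}
    {K : ProperCone ℝ E} {p : P} {x₀ : X} {r : ℝ}
    (hd : ∀ x ∈ Metric.closedBall x₀ r, DifferentiableAt ℝ G (p, x))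
    (hS : ∀ x ∈ Metric.closedBall x₀ r, ((p, x) ∈ S ↔ G (p, x) ∈ K))
    (hr : 0 < r) (hx₀ : G (p, x₀) ∈ K) {μ : StrongDual ℝ E} (hμ : μ ∈ dualCone (K : Set E))
    (hlt : -μ (G (p, x₀)) < r ^ 2) :
    ∃ x, ‖x - x₀‖ ^ 2 ≤ -μ (G (p, x₀)) ∧
      μ.comp ((fderiv ℝ G (p, x)).comp (ContinuousLinearMap.inr ℝ P X)) -
        (2 : ℝ) • innerSL ℝ (x - x₀) ∈ regularNormalCone {x | (p, x) ∈ S} x := by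
  have hd' : ∀ x ∈ Metric.closedBall x₀ r, HasFDerivAt (fun x => G (p, x))
      ((fderiv ℝ G (p, x)).comp (ContinuousLinearMap.inr ℝ P X)) x := fun x hx =>
    HasFDerivAt.comp x (g := G) (f := fun x => (p, x)) (hd x hx).hasFDerivAt
      (hasFDerivAt_prodMk_right p x)
  have hc : ContinuousOn (fun x => G (p, x)) (Metric.closedBall x₀ r) := fun x hx =>
    (hd' x hx).continuousAt.continuousWithinAt
  set B := Metric.closedBall x₀ r ∩ (fun x => G (p, x)) ⁻¹' (K : Set E) with hB
  have hBc : IsCompact B := (isCompact_closedBall x₀ r).of_isClosed_subset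
    (hc.preimage_isClosed_of_isClosed Metric.isClosed_closedBall K.isClosed) inter_subset_left
  have hx₀B : x₀ ∈ B := ⟨Metric.mem_closedBall_self hr.le, hx₀⟩
  -- Both terms are nonnegative on B because μ ∈ K*. Comparison with x₀ bounds the distance of a
  -- minimizer from x₀, which puts it inside the open ball, so it is a local minimizer on the whole
  -- fiber.
  set f : X → ℝ := fun x => -μ (G (p, x)) + ‖x - x₀‖ ^ 2 with hf
  have hfc : ContinuousOn f B := by
    refine ContinuousOn.add ((μ.continuous.comp_continuousOn (hc.mono inter_subset_left)).neg) ?_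
    exact Continuous.continuousOn (by fun_prop)
  obtain ⟨x, hxB, hmin⟩ := hBc.exists_isMinOn ⟨x₀, hx₀B⟩ hfc
  have h0 : f x ≤ -μ (G (p, x₀)) := (hmin hx₀B : f x ≤ f x₀).trans_eq (by simp [hf])
  have hle : ‖x - x₀‖ ^ 2 ≤ -μ (G (p, x₀)) := by
    have := hμ _ hxB.2
    simp only [hf] at h0
    linarith
  have hxr : ‖x - x₀‖ < r := lt_of_pow_lt_pow_left₀ 2 hr.le (hle.trans_lt hlt)
  have hxb : x ∈ Metric.ball x₀ r := by rwa [Metric.mem_ball, dist_eq_norm]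
  refine ⟨x, hle, ?_⟩
  have hfd : HasFDerivAt f (-(μ.comp ((fderiv ℝ G (p, x)).comp
      (ContinuousLinearMap.inr ℝ P X))) + (2 : ℝ) • innerSL ℝ (x - x₀)) x := by
    refine HasFDerivAt.add ((μ.hasFDerivAt.comp x (hd' x hxB.1)).neg) ?_
    have := ((hasFDerivAt_id x).sub_const x₀).norm_sq
    refine this.congr_fderiv ?_
    ext y
    simp
  have := neg_mem_regularNormalCone_of_isLocalMinOn (Ω := {x | (p, x) ∈ S})
    ((hS x hxB.1).2 hxB.2) hfd (by
      filter_upwards [self_mem_nhdsWithin, nhdsWithin_le_nhds (Metric.isOpen_ball.mem_nhds hxb)]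
        with y hy hyb
      have hyb' := Metric.ball_subset_closedBall hyb
      exact hmin ⟨hyb', (hS y hyb').1 hy⟩)
  convert this using 1
  abel

namespace LocalSystem

variable {G : P × X → E} {S : Set (P × X)} {K : ProperCone ℝ E} {c : ℝ} {z : P × X}

/-- Strictness allows the multipliers μ + t l, where l ∘ ∇_xG(z) supplies the part of u* missing
from μ ∘ D v. They vanish on lin K, so they are o(t²) at the corrected arc. The penalty lemma then
gives a point within o(t) whose normal differs from (μ + t l) ∘ ∇_xG by o(t). -/
theorem mem_graphicalDerivative_of_strict [FiniteDimensional ℝ X] [FiniteDimensional ℝ E]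
    (h : LocalSystem G S K c z) {xs us : StrongDual ℝ X} {v w : P × X} {μ : StrongDual ℝ E}
    (hμ : IsStrictMultiplier G K z xs μ) (hμd : IsDerivativeMultiplier G K z xs v us μ)
    (hv : fderiv ℝ G z v ∈ lin K)
    (hw : fderiv ℝ G z w + (1 / 2 : ℝ) • fderiv ℝ (fderiv ℝ G) z v v ∈ lin K) :
    us ∈ graphicalDerivative (fun y => normalCone {x | (y.1, x) ∈ S} y.2) z xs v := by
  set F := fderiv ℝ G z with hF
  set D := fderiv ℝ (fderiv ℝ G) z with hD
  set κ := F w + (1 / 2 : ℝ) • D v v with hκ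
  obtain ⟨l, hla, hl⟩ := exists_comp_eq_of_vanish
    (F.comp (ContinuousLinearMap.inr ℝ P X)) (lin K)
    (us - μ.comp ((D v).comp (ContinuousLinearMap.inr ℝ P X)))
    (fun y hy => by simp [hμd.apply_eq y hy, hD])
  obtain ⟨ε, hε, hεl⟩ := hμ.strict l hl
  obtain ⟨t, ht, ht0⟩ : ∃ t : ℕ → ℝ, (∀ n, 0 < t n) ∧ Tendsto t atTop (𝓝 0) :=
    ⟨_, tendsto_one_div_pos.1, tendsto_one_div_pos.2⟩
  -- A convex combination of μ and μ + ε l with weight t/ε.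
  have hμn : ∀ᶠ n in atTop, μ + t n • l ∈ dualCone (K : Set E) := by
    filter_upwards [ht0.eventually (gt_mem_nhds hε)] with n hn
    have := convex_dualCone (K : Set E) hμ.mem hεl (a := 1 - t n / ε) (b := t n / ε)
      (by rw [sub_nonneg, div_le_one hε]; exact hn.le) (by have := ht n; positivity) (by ring)
    convert this using 1
    rw [smul_add, smul_smul, div_mul_cancel₀ _ hε.ne']
    module
  have hlinμ : ∀ (s : ℝ), ∀ y ∈ lin K, (μ + s • l) y = 0 := fun s y hy => by
    simp [hl y hy, dualCone_eq_zero_of_mem_lin hμ.mem hy]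
  have hwn : Tendsto (fun n => v + t n • w) atTop (𝓝 v) :=
    tendsto_add_smul ht0 tendsto_const_nhds
  -- This cone point is the expansion of G/t along the arc up to o(t), so the correction of the arc
  -- is o(t²).
  obtain ⟨y, hy⟩ := h.exists_stable_seq ht ht0 hwn (k := fun n => F v + t n • κ)
    (fun n => (Submodule.add_mem _ hv (Submodule.smul_mem _ _ hw)).1)
  have hG2 := ContDiffAt.tendsto_inv_sq_smul_sub h.contDiffAt (v := v) ht ht0
    (tendsto_const_nhds (x := w))
  set ρ : ℕ → X := fun n => (t n)⁻¹ • (y n - (v + t n • w).2) with hρ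
  have hρ0 : Tendsto ρ atTop (𝓝 0) := by
    rw [tendsto_zero_iff_norm_tendsto_zero]
    have hlim := ((hG2.sub_const κ).norm).const_mul c
    rw [← hF, ← hD, ← hκ, sub_self, norm_zero, mul_zero] at hlim
    refine squeeze_zero' (Eventually.of_forall fun n => norm_nonneg _) (hy.mono fun n hn => ?_) hlim
    have e : (t n ^ 2)⁻¹ • (G (z + t n • (v + t n • w)) - G z - t n • F v) - κ =
        (t n)⁻¹ • ((t n)⁻¹ • G (z + t n • (v + t n • w)) - (F v + t n • κ)) := by
      have := (ht n).ne'
      rw [h.map_eq_zero, sub_zero, pow_two, mul_inv, ← smul_smul, smul_sub (t n)⁻¹ (G _),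
        inv_smul_smul₀ this, ← sub_sub _ (F v) (t n • κ), smul_sub _ _ (t n • κ),
        inv_smul_smul₀ this]
    rw [e, hρ, norm_smul, norm_smul, mul_left_comm]
    exact mul_le_mul_of_nonneg_left hn.2.2 (norm_nonneg _)
  set s : ℕ → P × X := fun n => w + (0, ρ n) with hs
  have hslim : Tendsto s atTop (𝓝 w) := by
    have : Tendsto (fun n => ((0 : P), ρ n)) atTop (𝓝 (0, 0)) := tendsto_const_nhds.prodMk_nhds hρ0
    have := this.const_add w
    rwa [Prod.mk_zero_zero, add_zero] at this
  have hvs : ∀ n, ((v + t n • w).1, y n) = v + t n • s n := fun n => by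
    ext
    · simp [hs]
    · have := smul_inv_smul₀ (ht n).ne' (y n - (v + t n • w).2)
      simp only [hs, hρ, Prod.snd_add, Prod.smul_snd, smul_add] at this ⊢
      rw [this]
      abel
  simp only [hvs] at hy
  set x₀ : ℕ → P × X := fun n => z + t n • (v + t n • s n) with hx₀
  have hvslim : Tendsto (fun n => v + t n • s n) atTop (𝓝 v) := tendsto_add_smul ht0 hslim
  have hx₀lim : Tendsto x₀ atTop (𝓝 z) := tendsto_add_smul ht0 hvslim
  have hG3 := ContDiffAt.tendsto_inv_sq_smul_sub h.contDiffAt (v := v) ht ht0 hslim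
  set δ : ℕ → ℝ := fun n => -(μ + t n • l) ((t n ^ 2)⁻¹ • (G (x₀ n) - G z - t n • F v)) with hδ
  have hμlim : Tendsto (fun n => μ + t n • l) atTop (𝓝 μ) :=
    tendsto_add_smul ht0 tendsto_const_nhds
  have hδ0 : Tendsto δ atTop (𝓝 0) := by
    have hap : Continuous fun q : StrongDual ℝ E × E => -q.1 q.2 := by fun_prop
    have := (hap.tendsto (μ, κ)).comp (hμlim.prodMk_nhds hG3)
    rwa [show -(μ, κ).1 (μ, κ).2 = 0 by simp [dualCone_eq_zero_of_mem_lin hμ.mem hw]] at this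
  have hδG : ∀ n, -(μ + t n • l) (G (x₀ n)) = t n ^ 2 * δ n := fun n => by
    have h1 := hlinμ (t n) _ hv
    have h2 := ht n
    simp only [hδ, h.map_eq_zero, sub_zero, map_smul, map_sub, h1, smul_eq_mul, mul_zero]
    field_simp
  obtain ⟨R, hR, hball⟩ := Metric.eventually_nhds_iff_ball.1
    (h.eventually_differentiableAt.and h.mem_iff)
  have hex : ∀ᶠ n in atTop, ∃ x, ‖x - (x₀ n).2‖ ^ 2 ≤ t n ^ 2 * δ n ∧
      (μ + t n • l).comp ((fderiv ℝ G ((x₀ n).1, x)).comp (ContinuousLinearMap.inr ℝ P X)) -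
        (2 : ℝ) • innerSL ℝ (x - (x₀ n).2) ∈ regularNormalCone {x | ((x₀ n).1, x) ∈ S} x := by
    filter_upwards [hy, hμn, hδ0.eventually (gt_mem_nhds one_pos),
      hx₀lim.eventually (Metric.ball_mem_nhds z (half_pos hR)),
      ht0.eventually (gt_mem_nhds (half_pos hR))] with n h1 h2 h3 h4 h5
    have hin : ∀ x ∈ Metric.closedBall (x₀ n).2 (t n), ((x₀ n).1, x) ∈ Metric.ball z R := by
      intro x hx
      rw [Prod.dist_eq, max_lt_iff] at h4
      rw [Metric.mem_closedBall] at hx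
      rw [Metric.mem_ball, Prod.dist_eq, max_lt_iff]
      have := dist_triangle x (x₀ n).2 z.2
      exact ⟨h4.1.trans (half_lt_self hR), by have := h4.2; dsimp only; linarith⟩
    -- Radius t is admissible because the defect is t² δ with δ < 1 eventually.
    have := exists_regularNormal_of_penalty (p := (x₀ n).1) (x₀ := (x₀ n).2) (S := S) (K := K)
      (fun x hx => (hball _ (hin x hx)).1) (fun x hx => (hball _ (hin x hx)).2) (ht n) h1.2.1 h2
      (by
        rw [Prod.mk.eta, hδG]
        have := ht n
        nlinarith [pow_pos this 2])
    rwa [Prod.mk.eta, hδG] at this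
  obtain ⟨x, hx⟩ := hex.choice
  set d : ℕ → X := fun n => (t n)⁻¹ • (x n - (x₀ n).2) with hddef
  have hd0 : Tendsto d atTop (𝓝 0) := by
    rw [tendsto_zero_iff_norm_tendsto_zero]
    have hlim : Tendsto (fun n => √(δ n)) atTop (𝓝 0) := by
      have := (Real.continuous_sqrt.tendsto 0).comp hδ0
      rwa [Real.sqrt_zero] at this
    refine squeeze_zero' (Eventually.of_forall fun n => norm_nonneg _) (hx.mono fun n hn => ?_) hlim
    refine Real.le_sqrt_of_sq_le ?_
    have h2 := ht n
    rw [hddef, norm_smul, mul_pow, norm_inv, Real.norm_of_nonneg h2.le, inv_pow,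
      inv_mul_le_iff₀ (by positivity)]
    exact hn.1
  set y₁ : ℕ → P × X := fun n => v + t n • s n + (0, d n) with hy₁
  have hy₁lim : Tendsto y₁ atTop (𝓝 v) := by
    have : Tendsto (fun n => ((0 : P), d n)) atTop (𝓝 (0, 0)) := tendsto_const_nhds.prodMk_nhds hd0
    have := hvslim.add this
    rwa [Prod.mk_zero_zero, add_zero] at this
  have hzy : ∀ n, z + t n • y₁ n = ((x₀ n).1, x n) := fun n => by
    have e : t n • d n = x n - (x₀ n).2 := smul_inv_smul₀ (ht n).ne' _
    have e' : z + t n • y₁ n = x₀ n + (0, t n • d n) := by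
      rw [hy₁, hx₀]
      simp only [smul_add, Prod.smul_mk, smul_zero]
      abel
    rw [e', e]
    ext <;> simp
  set N : ℕ → StrongDual ℝ X := fun n =>
    (μ + t n • l).comp ((fderiv ℝ G ((x₀ n).1, x n)).comp (ContinuousLinearMap.inr ℝ P X)) -
        (2 : ℝ) • innerSL ℝ (x n - (x₀ n).2) with hN
  have hNlim : Tendsto (fun n => (t n)⁻¹ • (N n - xs)) atTop (𝓝 us) := by
    have hDl := HasFDerivAt.tendsto_inv_smul_sub (E := P × X →L[ℝ] E) h.hasFDerivAt_fderiv
      ht ht0 hy₁lim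
    have hco : Continuous fun q : (StrongDual ℝ E × (P × X →L[ℝ] E)) × X =>
        q.1.1.comp (q.1.2.comp (ContinuousLinearMap.inr ℝ P X)) +
          (us - μ.comp ((D v).comp (ContinuousLinearMap.inr ℝ P X))) -
          (2 : ℝ) • innerSL ℝ q.2 := by fun_prop
    have hlim := (hco.tendsto ((μ, D v), 0)).comp ((hμlim.prodMk_nhds hDl).prodMk_nhds hd0)
    have e0 : us = μ.comp ((D v).comp (ContinuousLinearMap.inr ℝ P X)) +
          (us - μ.comp ((D v).comp (ContinuousLinearMap.inr ℝ P X))) -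
          (2 : ℝ) • innerSL ℝ (0 : X) := by simp
    rw [e0]
    refine hlim.congr fun n => ?_
    have hxn : x n - (x₀ n).2 = t n • d n := (smul_inv_smul₀ (ht n).ne' _).symm
    have htn := (ht n).ne'
    simp only [Function.comp_apply, hN, hzy, ← hla, ← hμ.comp_eq, hxn]
    ext b
    simp only [add_apply, sub_apply, smul_apply, ContinuousLinearMap.comp_apply, map_smul, map_sub,
      smul_eq_mul, innerSL_apply_apply, hF]
    field_simp
    ring
  refine mem_tangentCone_of_eventually ht ht0 (hy₁lim.prodMk_nhds hNlim) (hx.mono fun n hn => ?_)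
  change xs + t n • ((t n)⁻¹ • (N n - xs)) ∈ normalCone {x | ((z + t n • y₁ n).1, x) ∈ S}
    (z + t n • y₁ n).2
  rw [hzy, smul_inv_smul₀ (ht n).ne', add_sub_cancel]
  exact regularNormalCone_subset_normalCone _ _ hn.2

/-- The multiplier μ + s (μ₀ - μ) is strict for 0 < s < 1 and serves a functional that tends to `us`
as s ↓ 0. The tangent cone is closed, so the limit belongs to it. -/
theorem mem_graphicalDerivative [FiniteDimensional ℝ X] [FiniteDimensional ℝ E]
    (h : LocalSystem G S K c z) {xs us : StrongDual ℝ X} {v w : P × X} {μ₀ μ : StrongDual ℝ E}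
    (hμ₀ : IsStrictMultiplier G K z xs μ₀) (hμ : IsDerivativeMultiplier G K z xs v us μ)
    (hv : fderiv ℝ G z v ∈ lin K)
    (hw : fderiv ℝ G z w + (1 / 2 : ℝ) • fderiv ℝ (fderiv ℝ G) z v v ∈ lin K) :
    us ∈ graphicalDerivative (fun y => normalCone {x | (y.1, x) ∈ S} y.2) z xs v := by
  set D := fderiv ℝ (fderiv ℝ G) z with hD
  have hc : Continuous fun s : ℝ => (v, us + s • (μ₀ - μ).comp
      ((D v).comp (ContinuousLinearMap.inr ℝ P X))) := by fun_prop
  have hlim : Tendsto (fun s : ℝ => (v, us + s • (μ₀ - μ).comp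
      ((D v).comp (ContinuousLinearMap.inr ℝ P X)))) (𝓝[>] 0) (𝓝 (v, us)) :=
    tendsto_nhdsWithin_of_tendsto_nhds (by simpa using hc.tendsto 0)
  refine (isClosed_tangentCone _ _).mem_of_tendsto hlim ?_
  filter_upwards [Ioo_mem_nhdsGT one_pos] with s hs
  have hmem : ∀ ν ∈ dualCone (K : Set E), μ + s • (ν - μ) ∈ dualCone (K : Set E) := fun ν hν => by
    have := convex_dualCone (K : Set E) hμ.mem hν (a := 1 - s) (b := s) (by linarith [hs.2])
      hs.1.le (by ring)
    convert this using 1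
    module
  have hcomp : (μ + s • (μ₀ - μ)).comp
      ((fderiv ℝ G z).comp (ContinuousLinearMap.inr ℝ P X)) = xs := by
    rw [ContinuousLinearMap.add_comp, ContinuousLinearMap.smul_comp, ContinuousLinearMap.sub_comp,
      hμ.comp_eq, hμ₀.comp_eq, sub_self, smul_zero, add_zero]
  refine h.mem_graphicalDerivative_of_strict (μ := μ + s • (μ₀ - μ)) (w := w)
    ⟨hmem _ hμ₀.mem, hcomp, fun l hl => ?_⟩
    ⟨hmem _ hμ₀.mem, hcomp, hμ.tangent, dualCone_eq_zero_of_mem_lin (hmem _ hμ₀.mem) hv,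
      fun b hb => ?_⟩ hv hw
  · obtain ⟨ε, hε, hm⟩ := hμ₀.strict l hl
    -- The perturbed multiplier equals (1 - s) μ + s (μ₀ + ε l), a convex combination of elements of
    -- K*.
    refine ⟨s * ε, mul_pos hs.1 hε, ?_⟩
    convert hmem _ hm using 1
    module
  · simp [hμ.apply_eq b hb, hD]

end LocalSystem

end Realization

end PCS
-- Assembly for the reduced system G = h ∘ g
theorem mainTheorem6
    {P X Y E : Type*}
    [NormedAddCommGroup P] [InnerProductSpace ℝ P] [FiniteDimensional ℝ P]
    [NormedAddCommGroup X] [InnerProductSpace ℝ X] [FiniteDimensional ℝ X]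
    [NormedAddCommGroup Y] [InnerProductSpace ℝ Y] [FiniteDimensional ℝ Y]
    [NormedAddCommGroup E] [InnerProductSpace ℝ E] [FiniteDimensional ℝ E]
    (g : P × X → Y) (C : Set Y) (pbar : P) (xbar : X)
    (hC : IsClosed C) (hfeas : g (pbar, xbar) ∈ C)
    (hg : ContDiffAt ℝ 2 g (pbar, xbar))
    (V : Set Y) (h : Y → E) (K : ProperCone ℝ E)
    (hred : PCS.IsC2Reduction C (g (pbar, xbar)) V h K)
    (xs : StrongDual ℝ X)
    (hxs : xs ∈ PCS.normalConeMap g C (pbar, xbar))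
    (G : P × X → E) (hG : G = fun z => h (g z))
    (hRS : PCS.RobinsonStability G (K : Set E) (pbar, xbar))
    (hSC : PCS.StrictComplementarity (fun x => G (pbar, x)) (K : Set E) xbar xs)
    (q : P) (u : X) (hq : q ∈ PCS.characteristicSubspace G K (pbar, xbar)) :
    PCS.graphicalDerivative (PCS.normalConeMap g C) (pbar, xbar) xs (q, u) ⊆
        PCS.derivativeEstimate (PCS.graph (PCS.solutionMap g C)) G K (pbar, xbar) xs (q, u) ∧
      (fderiv ℝ (fderiv ℝ G) (pbar, xbar) (q, u) (q, u) ∈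
          LinearMap.range (fderiv ℝ G (pbar, xbar)).toLinearMap ⊔ PCS.lin K →
        PCS.graphicalDerivative (PCS.normalConeMap g C) (pbar, xbar) xs (q, u) =
          PCS.derivativeEstimate (PCS.graph (PCS.solutionMap g C)) G K (pbar, xbar) xs (q, u)) := by
  have hGz : G (pbar, xbar) = 0 := by rw [hG]; exact hred.map_eq_zero
  have hGc : ContDiffAt ℝ 2 G (pbar, xbar) := by
    rw [hG]
    exact (hred.contDiffOn.contDiffAt (hred.isOpen.mem_nhds hred.mem)).comp (pbar, xbar) hg
  have hS : ∀ᶠ y in 𝓝 (pbar, xbar), (y ∈ PCS.graph (PCS.solutionMap g C) ↔ G y ∈ K) := by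
    filter_upwards [hg.continuousAt.eventually (hred.isOpen.mem_nhds hred.mem)] with y hy
    have := Set.ext_iff.1 hred.inter_eq (g y)
    have hy' : g y ∈ V := hy
    rw [hG]
    exact ⟨fun hm => (this.1 ⟨hm, hy'⟩).2, fun hm => (this.2 ⟨hy', hm⟩).1⟩
  obtain ⟨c, hL⟩ := hRS.exists_localSystem hGc hGz hS
  obtain ⟨μ₀, hμ₀, hxsμ⟩ := hSC
  simp only [hGz, PCS.normalCone_zero_eq_dualCone] at hμ₀
  have hstrict : PCS.IsStrictMultiplier G K (pbar, xbar) xs μ₀ := by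
    refine ⟨intrinsicInterior_subset hμ₀, ?_, fun l hl => PCS.exists_add_smul_mem_dualCone hμ₀ hl⟩
    rw [hxsμ, ← PCS.partialX_eq hL.eventually_differentiableAt.self_of_nhds]
    rfl
  have hsub : PCS.graphicalDerivative (PCS.normalConeMap g C) (pbar, xbar) xs (q, u) ⊆
      PCS.derivativeEstimate (PCS.graph (PCS.solutionMap g C)) G K (pbar, xbar) xs (q, u) :=
    fun us hus => (hL.mem_derivativeEstimate_iff hstrict hq u us).2
      (hL.exists_derivativeMultiplier hus)
  refine ⟨hsub, fun hrge => hsub.antisymm fun us hus => ?_⟩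
  obtain ⟨μ, hμ⟩ := (hL.mem_derivativeEstimate_iff hstrict hq u us).1 hus
  obtain ⟨_, ⟨w, rfl⟩, l, hl, he⟩ := Submodule.mem_sup.1 hrge
  -- With ∇²G(v, v) = ∇G w + l, this choice cancels the range part and leaves l/2 ∈ lin K.
  refine hL.mem_graphicalDerivative (w := -((1 / 2 : ℝ) • w)) hstrict hμ
    (hL.fderiv_mem_lin hstrict hq hμ.mem hμ.comp_eq hμ.tangent hμ.compl) ?_
  rw [← he]
  convert Submodule.smul_mem (PCS.lin K) (1 / 2 : ℝ) hl using 1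
  simp
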